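/- For real $s\ge 0$ let $H^s=H^s(\mathbb{R})$ denote the $L^2$-based Sobolev space of real-valued functions on $\mathbb{R}$, and let $[s]$ denote the integer part of $s$. Let $s\ge 0$, $\zeta\in C^2([0,\infty),H^s)\cap C([0,\infty),H^{[s]+1})$ and $\eta_0\in H^s$. Then the initial value problem $$\eta_t+\left(\eta+\tfrac34\eta^2-\tfrac12\zeta\eta\right)_x-\tfrac16\eta_{xxt}=-\tfrac14\zeta_{xtt}+\tfrac12\zeta_t,\qquad x\in\mathbb{R},\ t\ge 0,\qquad \eta(\cdot,0)=\eta_0,$$ has a unique solution $\eta\in C([0,\infty),H^s)$. Here $\zeta_t,\zeta_{tt}\in C([0,\infty),H^s)$ are the derivatives of the curve $\zeta$ (one-sided at $t=0$), and the equation is understood in the sense of distributions: for every Schwartz function $\varphi$ on $\mathbb{R}$ the function $t\mapsto\int_{\mathbb{R}}\eta(x,t)\varphi(x)\,dx$ is differentiable on $[0,\infty)$ (one-sidedly at $t=0$), this defines $\eta_t(\cdot,t)$ as a tempered distribution on $\mathbb{R}$, and for every $t\ge0$ the equation, with $\eta_{xxt}=(\eta_t)_{xx}$, holds as an identity of tempered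 distributions on $\mathbb{R}$. -/

import Mathlib

open MeasureTheory Set
open scoped SchwartzMap ENNReal

noncomputable section

namespace BBM

/-- The complexification `Lᵖ(ℝ; ℝ) → Lᵖ(ℝ; ℂ)`. -/
def toComplex (p : ℝ≥0∞) [Fact (1 ≤ p)] :
    Lp ℝ p (volume : Measure ℝ) →L[ℝ] Lp ℂ p (volume : Measure ℝ) :=
  Complex.ofRealCLM.compLpL p volume

/-- A real-valued `Lᵖ` function `f` as the tempered distribution `φ ↦ ∫ φ(x) f(x) dx`. -/
def toDist {p : ℝ≥0∞} [Fact (1 ≤ p)] : Lp ℝ p (volume : Measure ℝ) →ₗ[ℝ] 𝓢'(ℝ, ℂ) :=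
  (Lp.toTemperedDistributionCLM ℂ volume p).toLinearMap.restrictScalars ℝ ∘ₗ
    (toComplex p).toLinearMap

/-- The distributional derivative `∂ₓ` on `𝓢'(ℝ)`. -/
abbrev dx : 𝓢'(ℝ, ℂ) →L[ℂ] 𝓢'(ℝ, ℂ) := TemperedDistribution.derivCLM ℂ

/-- The real-valued functions of `Hˢ(ℝ)`, `s ≥ 0`, as a subspace of `L²(ℝ; ℝ)`. -/
def sobolevSubmodule (s : ℝ) : Submodule ℝ (Lp ℝ 2 (volume : Measure ℝ)) where
  carrier := {f | TemperedDistribution.MemSobolev s 2 (toDist f)}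
  add_mem' {f g} hf hg := by
    change TemperedDistribution.MemSobolev s 2 (toDist (f + g))
    rw [map_add]
    exact TemperedDistribution.MemSobolev.add hf hg
  zero_mem' := by
    change TemperedDistribution.MemSobolev s 2 (toDist 0)
    rw [map_zero]
    exact TemperedDistribution.memSobolev_fun_zero ℝ ℂ s 2
  smul_mem' c f hf := by
    change TemperedDistribution.MemSobolev s 2 (toDist (c • f))
    rw [map_smul]
    exact TemperedDistribution.MemSobolev.smul (c : ℂ) hf

/-- The space `Hˢ(ℝ)` (`s ≥ 0`) of real-valued functions. It is a type of its own, because its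
norm is not the norm of `L²`. -/
def Hs (s : ℝ) : Type := sobolevSubmodule s

instance (s : ℝ) : AddCommGroup (Hs s) := inferInstanceAs (AddCommGroup (sobolevSubmodule s))

instance (s : ℝ) : Module ℝ (Hs s) := inferInstanceAs (Module ℝ (sobolevSubmodule s))

/-- The inclusion `Hˢ(ℝ) ⊆ L²(ℝ)`. -/
def Hs.toL2 {s : ℝ} : Hs s →ₗ[ℝ] Lp ℝ 2 (volume : Measure ℝ) := (sobolevSubmodule s).subtype

/-- The tempered distribution given by an element of `Hˢ(ℝ)`. -/
def Hs.toDist {s : ℝ} : Hs s →ₗ[ℝ] 𝓢'(ℝ, ℂ) := BBM.toDist ∘ₗ Hs.toL2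

theorem toDist_injective {p : ℝ≥0∞} [Fact (1 ≤ p)] :
    Function.Injective (toDist : Lp ℝ p (volume : Measure ℝ) → 𝓢'(ℝ, ℂ)) := by
  intro f g h
  have h1 : toComplex p f = toComplex p g :=
    LinearMap.ker_eq_bot.mp
      (Lp.ker_toTemperedDistributionCLM_eq_bot (F := ℂ) (μ := (volume : Measure ℝ)) (p := p)) h
  apply Lp.ext
  have hf := Complex.ofRealCLM.coeFn_compLpL (p := p) (μ := (volume : Measure ℝ)) f
  have hg := Complex.ofRealCLM.coeFn_compLpL (p := p) (μ := (volume : Measure ℝ)) g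
  have h2 : Complex.ofRealCLM.compLpL p volume f = Complex.ofRealCLM.compLpL p volume g := h1
  rw [h2] at hf
  filter_upwards [hf, hg] with x hx hy
  simpa using hx.symm.trans hy

theorem Hs.exists_bessel {s : ℝ} (u : Hs s) : ∃ f : Lp ℂ 2 (volume : Measure ℝ),
    TemperedDistribution.besselPotential ℝ ℂ s u.toDist = Lp.toTemperedDistributionCLM ℂ volume 2 f :=
  u.2

theorem Lp_toTemperedDistribution_injective : Function.Injective
    (Lp.toTemperedDistributionCLM (E := ℝ) ℂ volume 2) :=
  LinearMap.ker_eq_bot.mp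
    (Lp.ker_toTemperedDistributionCLM_eq_bot (F := ℂ) (μ := (volume : Measure ℝ)) (p := 2))

/-- The Bessel potential `Jˢ : Hˢ(ℝ) → L²(ℝ; ℂ)`, the Fourier multiplier with symbol
`(1 + ξ²)^(s/2)`. -/
def Hs.bessel {s : ℝ} : Hs s →ₗ[ℝ] Lp ℂ 2 (volume : Measure ℝ) where
  toFun u := u.exists_bessel.choose
  map_add' u v := by
    apply Lp_toTemperedDistribution_injective
    rw [map_add (Lp.toTemperedDistributionCLM (E := ℝ) ℂ volume 2), ← u.exists_bessel.choose_spec, ← v.exists_bessel.choose_spec,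
      ← (u + v).exists_bessel.choose_spec, map_add, map_add]
  map_smul' c u := by
    apply Lp_toTemperedDistribution_injective
    have h : Lp.toTemperedDistributionCLM ℂ volume 2 (c • u.exists_bessel.choose) =
        c • Lp.toTemperedDistributionCLM (E := ℝ) ℂ volume 2 u.exists_bessel.choose :=
      map_smul (Lp.toTemperedDistributionCLM (E := ℝ) ℂ volume 2) (c : ℂ) _
    rw [RingHom.id_apply, h, ← u.exists_bessel.choose_spec,
      ← (c • u).exists_bessel.choose_spec, map_smul]
    exact map_smul (TemperedDistribution.besselPotential ℝ ℂ s) (c : ℂ) _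

theorem Hs.bessel_spec {s : ℝ} (u : Hs s) :
    TemperedDistribution.besselPotential ℝ ℂ s u.toDist =
      Lp.toTemperedDistributionCLM ℂ volume 2 (Hs.bessel u) :=
  u.exists_bessel.choose_spec

theorem Hs.bessel_injective {s : ℝ} : Function.Injective (Hs.bessel (s := s)) := by
  intro u v h
  have h1 : TemperedDistribution.besselPotential ℝ ℂ s u.toDist =
      TemperedDistribution.besselPotential ℝ ℂ s v.toDist := by
    rw [u.bessel_spec, v.bessel_spec, h]
  have h2 := congrArg (TemperedDistribution.besselPotential ℝ ℂ (-s)) h1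
  simp only [TemperedDistribution.besselPotential_besselPotential_apply, add_neg_cancel,
    TemperedDistribution.besselPotential_zero, ContinuousLinearMap.id_apply] at h2
  exact Subtype.ext (toDist_injective h2)

/-- The norm of `Hˢ(ℝ)` is `‖u‖ₛ = ‖Jˢ u‖` with the norm of `L²` on the right. -/
instance (s : ℝ) : NormedAddCommGroup (Hs s) :=
  NormedAddCommGroup.induced (Hs s) (Lp ℂ 2 (volume : Measure ℝ)) Hs.bessel Hs.bessel_injective

instance (s : ℝ) : NormedSpace ℝ (Hs s) :=
  NormedSpace.induced ℝ (Hs s) (Lp ℂ 2 (volume : Measure ℝ)) Hs.bessel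

/-- The pointwise product of two functions in `L²`, as a function in `L¹`. -/
def prod (f g : Lp ℝ 2 (volume : Measure ℝ)) : Lp ℝ 1 (volume : Measure ℝ) := f • g

/-- `T'` is the derivative in time, on `[0, ∞)` and in the sense of distributions in `x` (one-sided
at `t = 0`), of the curve of distributions `T`. -/
def HasTimeDeriv (T T' : ℝ → 𝓢'(ℝ, ℂ)) : Prop :=
  ∀ t ∈ Ici (0 : ℝ), ∀ φ : 𝓢(ℝ, ℂ), HasDerivWithinAt (fun τ ↦ T τ φ) (T' t φ) (Ici 0) t

/-- `η ∈ C([0, ∞), Hˢ)` solves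
`η_t + (η + ¾ η² - ½ ζ η)_x - ⅙ η_xxt = -¼ ζ_xtt + ½ ζ_t`, `η(0) = η₀`,
where `ζ_t`, `ζ_tt` are the derivatives of the curve `ζ : [0, ∞) → Hˢ` and the other derivatives
are in the sense of distributions. -/
structure IsSolution {s : ℝ} (ζ : ℝ → Hs s) (η₀ : Hs s) (η : ℝ → Hs s) : Prop where
  continuousOn : ContinuousOn η (Ici 0)
  initial : η 0 = η₀
  equation : ∃ η_t : ℝ → 𝓢'(ℝ, ℂ), HasTimeDeriv (fun t ↦ (η t).toDist) η_t ∧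
    ∀ t ∈ Ici (0 : ℝ),
      η_t t
        + dx ((η t).toDist + (3 / 4 : ℂ) • toDist (prod (η t).toL2 (η t).toL2)
            - (1 / 2 : ℂ) • toDist (prod (ζ t).toL2 (η t).toL2))
        - (1 / 6 : ℂ) • dx (dx (η_t t))
      = -(1 / 4 : ℂ) • dx (iteratedDerivWithin 2 ζ (Ici 0) t).toDist
        + (1 / 2 : ℂ) • (derivWithin ζ (Ici 0) t).toDist

end BBM

end

/-! Since `1 - ∂ₓ²/6` is invertible on tempered distributions, the equation says exactly that `η_t =
-(1 - ∂ₓ²/6)⁻¹∂ₓ(η + ¾η² - ½ζη) + h` with `h = (1 - ∂ₓ²/6)⁻¹(-¼ζ_xtt + ½ζ_t)` (`equation_iff`).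
Along a weak solution that is continuous in `Hˢ` the right-hand side is continuous in `Hˢ`, so the
solution is a classical solution of an ODE in the Banach space `Hˢ` (`isSolution_iff`).

The right-hand side is quadratic, and `(u, v) ↦ (1 - ∂ₓ²/6)⁻¹∂ₓ(uv)` is bounded on `Hˢ` for every `s
≥ 0` (`exists_bilinear`): by Cauchy–Schwarz the weighted Fourier transform of `uv` is bounded, and
the symbol of `(1 - ∂ₓ²/6)⁻¹∂ₓ` is square integrable. The field is therefore Lipschitz on bounded
sets. Uniqueness follows from Gronwall, and global existence reduces to a priori bounds on each `[0,
T]`.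

For `s = 0` the available energy lives in `H¹` while the data are only in `L²`. The initial value is
split into `w₀ ∈ H¹` and a remainder `v₀` that is small in `L²`. The part `v` solves the equation
without forcing and without the linear flux, and smallness persists up to time `T`
(`exists_small_solution`). The part `w` absorbs everything else in `H¹` (`exists_energy_solution`).
In the inner product `⟨v, w⟩ + ⟨v_x, w_x⟩/6` the only cubic contribution is a multiple of `∫ w² w_x
= 0`, so Gronwall applies to `‖w‖²`.

For general `s` the bilinear estimate is tame: each term on its right has only one factor in the
`Hˢ` norm, the other in the `L²` norm. An `Hˢ` solution is also an `L²` solution, hence equals the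
one already found and obeys its `L²` bound. The growth in `Hˢ` is then linear, and Gronwall closes
the argument (`exists_isSolOn`). -/

noncomputable section

namespace BBM

open Filter Topology Metric
open scoped NNReal

/-! ### Ordinary differential equations in Banach spaces -/

section ODE

variable {E : Type*} [NormedAddCommGroup E]

/-- The vector field `f` is continuous in time and Lipschitz continuous on bounded sets, uniformly
for `t ∈ [0, T]`. -/
structure IsLocLip (f : ℝ → E → E) (T : ℝ) : Prop where
  continuousOn : ∀ x, ContinuousOn (fun t ↦ f t x) (Icc 0 T)
  lipschitzOnWith : ∀ R : ℝ, ∃ K : ℝ≥0, ∀ t ∈ Icc 0 T, LipschitzOnWith K (f t) (closedBall 0 R)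

theorem IsLocLip.mono {f : ℝ → E → E} {T T' : ℝ} (hf : IsLocLip f T) (h : T' ≤ T) :
    IsLocLip f T' where
  continuousOn x := (hf.continuousOn x).mono (Icc_subset_Icc_right h)
  lipschitzOnWith R := by
    obtain ⟨K, hK⟩ := hf.lipschitzOnWith R
    exact ⟨K, fun t ht ↦ hK t (Icc_subset_Icc_right h ht)⟩

variable [NormedSpace ℝ E]

/-- The radial retraction onto the closed ball of radius `R`. -/
def radialRetraction (R : ℝ) (x : E) : E := (R / max R ‖x‖) • x

theorem radialRetraction_of_norm_le {R : ℝ} (hR : 0 < R) {x : E} (hx : ‖x‖ ≤ R) :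
    radialRetraction R x = x := by
  rw [radialRetraction, max_eq_left hx, div_self hR.ne', one_smul]

theorem norm_radialRetraction_le {R : ℝ} (hR : 0 < R) (x : E) : ‖radialRetraction R x‖ ≤ R := by
  have h : 0 < max R ‖x‖ := lt_max_of_lt_left hR
  rw [radialRetraction, norm_smul, Real.norm_of_nonneg (by positivity), div_mul_eq_mul_div,
    div_le_iff₀ h]
  exact mul_le_mul_of_nonneg_left (le_max_right _ _) hR.le

/-- One unit of the constant comes from moving the point at a fixed scaling factor, the other from
the change of the factor. This works in any normed space; no inner product is needed. -/
theorem lipschitzWith_radialRetraction {R : ℝ} (hR : 0 < R) :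
    LipschitzWith 2 (radialRetraction R : E → E) := by
  refine LipschitzWith.of_dist_le_mul fun x y ↦ ?_
  rw [dist_eq_norm, dist_eq_norm]
  have hx : 0 < max R ‖x‖ := lt_max_of_lt_left hR
  have hy : 0 < max R ‖y‖ := lt_max_of_lt_left hR
  have e : radialRetraction R x - radialRetraction R y =
      (R / max R ‖x‖) • (x - y) + (R / max R ‖x‖ - R / max R ‖y‖) • y := by
    simp only [radialRetraction, smul_sub, sub_smul]
    abel
  have h1 : ‖(R / max R ‖x‖) • (x - y)‖ ≤ ‖x - y‖ := by
    rw [norm_smul, Real.norm_of_nonneg (by positivity)]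
    refine mul_le_of_le_one_left (norm_nonneg _) ?_
    rw [div_le_one hx]
    exact le_max_left _ _
  have h2 : ‖(R / max R ‖x‖ - R / max R ‖y‖) • y‖ ≤ ‖x - y‖ := by
    have h3 : R / max R ‖x‖ - R / max R ‖y‖ =
        (R / max R ‖x‖) * ((max R ‖y‖ - max R ‖x‖) / max R ‖y‖) := by
      field_simp
    have h4 : |max R ‖y‖ - max R ‖x‖| ≤ ‖x - y‖ := by
      rw [max_comm R, max_comm R, norm_sub_rev]
      exact (abs_max_sub_max_le_abs _ _ R).trans (abs_norm_sub_norm_le y x)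
    rw [norm_smul, h3, norm_mul, Real.norm_of_nonneg (by positivity : 0 ≤ R / max R ‖x‖), norm_div,
      Real.norm_of_nonneg hy.le, Real.norm_eq_abs]
    have h5 : R / max R ‖x‖ ≤ 1 := by
      rw [div_le_one hx]
      exact le_max_left _ _
    have h6 : ‖y‖ / max R ‖y‖ ≤ 1 := by
      rw [div_le_one hy]
      exact le_max_right _ _
    calc _ = (R / max R ‖x‖) * (‖y‖ / max R ‖y‖) * |max R ‖y‖ - max R ‖x‖| := by ring
      _ ≤ 1 * 1 * ‖x - y‖ := by gcongr
      _ = ‖x - y‖ := by ring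
  rw [e]
  refine (norm_add_le _ _).trans ?_
  push_cast
  linarith

/-- `y` solves `y' = f(t, y)`, `y(0) = x₀` on `[0, T]`. -/
structure IsSolOn (f : ℝ → E → E) (x₀ : E) (T : ℝ) (y : ℝ → E) : Prop where
  initial : y 0 = x₀
  deriv : ∀ t ∈ Icc 0 T, HasDerivWithinAt y (f t (y t)) (Icc 0 T) t

namespace IsSolOn

variable {f : ℝ → E → E} {x₀ : E} {T : ℝ} {y z : ℝ → E}

theorem continuousOn (h : IsSolOn f x₀ T y) : ContinuousOn y (Icc 0 T) :=
  fun t ht ↦ (h.deriv t ht).continuousWithinAt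

theorem mono (h : IsSolOn f x₀ T y) {T' : ℝ} (hT : T' ≤ T) : IsSolOn f x₀ T' y where
  initial := h.initial
  deriv t ht := (h.deriv t (Icc_subset_Icc_right hT ht)).mono (Icc_subset_Icc_right hT)

theorem derivRight (h : IsSolOn f x₀ T y) :
    ∀ t ∈ Ico 0 T, HasDerivWithinAt y (f t (y t)) (Ici t) t := fun t ht ↦
  ((h.deriv t (Ico_subset_Icc_self ht)).mono_of_mem_nhdsWithin (Icc_mem_nhdsGE_of_mem ht))

theorem exists_norm_le (h : IsSolOn f x₀ T y) : ∃ R, ∀ t ∈ Icc 0 T, ‖y t‖ ≤ R :=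
  isCompact_Icc.exists_bound_of_continuousOn h.continuousOn

theorem eqOn (hf : IsLocLip f T) (hy : IsSolOn f x₀ T y) (hz : IsSolOn f x₀ T z) :
    EqOn y z (Icc 0 T) := by
  -- Both curves are bounded on the compact interval, so one Lipschitz constant on a common ball
  -- suffices for Gronwall.
  obtain ⟨R, hR⟩ := hy.exists_norm_le
  obtain ⟨S, hS⟩ := hz.exists_norm_le
  obtain ⟨K, hK⟩ := hf.lipschitzOnWith (max R S)
  refine ODE_solution_unique_of_mem_Icc_right (s := fun _ ↦ closedBall 0 (max R S))
    (fun t ht ↦ hK t (Ico_subset_Icc_self ht)) hy.continuousOn hy.derivRight ?_ hz.continuousOn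
    hz.derivRight ?_ (hy.initial.trans hz.initial.symm)
  · intro t ht
    simpa using Or.inl (hR t (Ico_subset_Icc_self ht))
  · intro t ht
    simpa using Or.inr (hS t (Ico_subset_Icc_self ht))

end IsSolOn

/-- Composing with the retraction makes the field globally Lipschitz and bounded by some `L`.
Picard–Lindelöf then covers all of `[0, T]` at once, in the ball of radius `L * T` about `x₀`. -/
theorem IsLocLip.exists_truncated [CompleteSpace E] {f : ℝ → E → E} {T : ℝ}
    (hf : IsLocLip f T) (hT : 0 ≤ T)
    (x₀ : E) {R : ℝ} (hR : 0 < R) :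
    ∃ y, IsSolOn (fun t x ↦ f t (radialRetraction R x)) x₀ T y := by
  obtain ⟨K, hK⟩ := hf.lipschitzOnWith R
  obtain ⟨C, hC⟩ := isCompact_Icc.exists_bound_of_continuousOn (hf.continuousOn 0)
  have hC0 : 0 ≤ C := (norm_nonneg _).trans (hC 0 ⟨le_rfl, hT⟩)
  set L : ℝ≥0 := ⟨C + K * R, by positivity⟩ with hL
  have hbd : ∀ t ∈ Icc 0 T, ∀ x : E, ‖f t (radialRetraction R x)‖ ≤ L := by
    intro t ht x
    have hx := norm_radialRetraction_le hR x
    have h1 := (hK t ht).dist_le_mul (radialRetraction R x) (by simpa using hx) 0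
      (by simpa using hR.le)
    rw [dist_eq_norm, dist_eq_norm, sub_zero] at h1
    calc ‖f t (radialRetraction R x)‖ ≤ ‖f t 0‖ + ‖f t (radialRetraction R x) - f t 0‖ :=
          norm_le_norm_add_norm_sub' _ _
      _ ≤ C + K * R := add_le_add (hC t ht) (h1.trans (by gcongr))
  have hPL : IsPicardLindelof (fun t x ↦ f t (radialRetraction R x))
      (⟨0, le_rfl, hT⟩ : Icc 0 T) x₀ (L * ⟨T, hT⟩) 0 L (K * 2) := by
    refine ⟨fun t ht ↦ ?_, fun x _ ↦ hf.continuousOn _, fun t ht x _ ↦ hbd t ht x, ?_⟩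
    · refine (hK t ht).comp ((lipschitzWith_radialRetraction hR).lipschitzOnWith) ?_
      intro x _
      simpa using norm_radialRetraction_le hR x
    · simp only [sub_zero, sub_self, max_eq_left hT, NNReal.coe_zero]
      exact (NNReal.coe_mul L ⟨T, hT⟩).symm.le
  obtain ⟨y, h0, hy⟩ := hPL.exists_eq_forall_mem_Icc_hasDerivWithinAt₀
  exact ⟨y, h0, hy⟩

/-- Existence on `[0, T]` from an a priori bound that may be bootstrapped: solutions bounded by
`R` on a shorter interval are bounded by `A < R` there. -/
theorem IsLocLip.exists_isSolOn [CompleteSpace E] {f : ℝ → E → E} {T : ℝ}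
    (hf : IsLocLip f T) (hT : 0 ≤ T)
    {x₀ : E} {A R : ℝ} (hx₀ : ‖x₀‖ ≤ A) (hAR : A < R)
    (H : ∀ T' ∈ Icc 0 T, ∀ y, IsSolOn f x₀ T' y → (∀ t ∈ Icc 0 T', ‖y t‖ ≤ R) →
      ∀ t ∈ Icc 0 T', ‖y t‖ ≤ A) :
    ∃ y, IsSolOn f x₀ T y ∧ ∀ t ∈ Icc 0 T, ‖y t‖ ≤ A := by
  have hR : 0 < R := ((norm_nonneg _).trans hx₀).trans_lt hAR
  obtain ⟨y, hy⟩ := hf.exists_truncated hT x₀ hR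
  have key : ∀ T' ∈ Icc 0 T, (∀ t ∈ Icc 0 T', ‖y t‖ ≤ R) → IsSolOn f x₀ T' y := by
    intro T' hT' h
    refine ⟨hy.initial, fun t ht ↦ ?_⟩
    have := (hy.mono hT'.2).deriv t ht
    rwa [radialRetraction_of_norm_le hR (h t ht)] at this
  -- Continuous induction: the times up to which the truncated solution stays in the ball form a
  -- closed set. It extends to the right because the bootstrap improves `R` to `A < R`. In the ball
  -- the truncation is invisible.
  have hsub : Icc 0 T ⊆ {t | ∀ τ ∈ Icc 0 t, ‖y τ‖ ≤ R} := by
    have hnc : ContinuousOn (fun t ↦ ‖y t‖) (Icc 0 T) := hy.continuousOn.norm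
    apply IsClosed.Icc_subset_of_forall_exists_gt
    · rw [← isSeqClosed_iff_isClosed]
      intro u t hu htu
      have ht : t ∈ Icc 0 T := isClosed_Icc.mem_of_tendsto htu
        (Eventually.of_forall fun n ↦ (hu n).2)
      refine ⟨fun τ hτ ↦ ?_, ht⟩
      rcases hτ.2.lt_or_eq with h | h
      · obtain ⟨n, hn⟩ := (htu.eventually (lt_mem_nhds h)).exists
        exact (hu n).1 τ ⟨hτ.1, hn.le⟩
      · subst h
        have h1 : Tendsto (fun n ↦ ‖y (u n)‖) atTop (𝓝 ‖y τ‖) :=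
          (hnc τ ht).tendsto.comp
            (tendsto_nhdsWithin_iff.2 ⟨htu, Eventually.of_forall fun n ↦ (hu n).2⟩)
        exact le_of_tendsto h1 (Eventually.of_forall fun n ↦ (hu n).1 _ ⟨(hu n).2.1, le_rfl⟩)
    · intro τ hτ
      have : τ = 0 := le_antisymm hτ.2 hτ.1
      rw [this, hy.initial]
      exact hx₀.trans hAR.le
    · intro t ht t' ht'
      have htT : t ∈ Icc 0 T := Ico_subset_Icc_self ht.2
      have hA := H t htT y (key t htT ht.1) ht.1 t ⟨htT.1, le_rfl⟩
      have hev : ∀ᶠ τ in 𝓝[Icc 0 T] t, ‖y τ‖ < R :=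
          (hnc t htT).eventually_lt_const (hA.trans_lt hAR)
      have hev' : ∀ᶠ τ in 𝓝[≥] t, ‖y τ‖ < R :=
        hev.filter_mono (nhdsWithin_le_of_mem (Icc_mem_nhdsGE_of_mem ht.2))
      obtain ⟨u, hu, hu'⟩ := mem_nhdsGE_iff_exists_Icc_subset.1 hev'
      have hlt : t < min u t' := lt_min hu ht'
      refine ⟨min u t', fun τ hτ ↦ ?_, hlt, min_le_right _ _⟩
      rcases le_total τ t with h | h
      · exact ht.1 τ ⟨hτ.1, h⟩
      · exact (hu' ⟨h, hτ.2.trans (min_le_left _ _)⟩ : ‖y τ‖ < R).le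
  have hbd := hsub ⟨hT, le_rfl⟩
  exact ⟨y, key T ⟨hT, le_rfl⟩ hbd, H T ⟨hT, le_rfl⟩ y (key T ⟨hT, le_rfl⟩ hbd) hbd⟩

/-- By uniqueness the solutions on different intervals agree on overlaps and can be glued.
Evaluating the solution for the interval `[0, |t| + 1]` at `t` leaves room to the right of `t`, so
the derivative within `[0, ∞)` is recovered. -/
theorem exists_global_solution {f : ℝ → E → E} {x₀ : E} (hf : ∀ T, IsLocLip f T)
    (H : ∀ T, 0 ≤ T → ∃ y, IsSolOn f x₀ T y) :
    ∃ y : ℝ → E, y 0 = x₀ ∧ ∀ t ∈ Ici (0 : ℝ), HasDerivWithinAt y (f t (y t)) (Ici 0) t := by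
  choose! Y hY using H
  have hagree : ∀ T ≥ 0, EqOn (fun t ↦ Y (|t| + 1) t) (Y T) (Icc 0 T) := by
    intro T hT t ht
    have h1 : 0 ≤ min T (|t| + 1) := le_min hT (by positivity)
    have ht0 : |t| = t := abs_of_nonneg ht.1
    exact IsSolOn.eqOn (hf _) ((hY (|t| + 1) (by positivity)).mono (min_le_right T _))
      ((hY T hT).mono (min_le_left _ _)) ⟨ht.1, le_min ht.2 (by linarith)⟩
  refine ⟨fun t ↦ Y (|t| + 1) t, (hY _ (by positivity)).initial, fun t ht ↦ ?_⟩
  have ht0 : (0 : ℝ) ≤ t := ht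
  have hmem : t ∈ Icc 0 (t + 1) := ⟨ht0, by linarith⟩
  have h1 := (hY (t + 1) (by linarith)).deriv t hmem
  have h2 : HasDerivWithinAt (fun t ↦ Y (|t| + 1) t) (f t (Y (t + 1) t)) (Icc 0 (t + 1)) t :=
    h1.congr (hagree _ (by linarith)) (hagree _ (by linarith) hmem)
  have h3 : Y (|t| + 1) t = Y (t + 1) t := by rw [abs_of_nonneg ht0]
  beta_reduce
  rw [h3]
  refine h2.mono_of_mem_nhdsWithin ?_
  rw [← Ici_inter_Iic]
  exact inter_mem_nhdsWithin _ (Iic_mem_nhds (by linarith))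

/-- A vector field `c(t) + L(t) x + B(x, x)` with continuous coefficients. -/
theorem isLocLip_quadratic {c : ℝ → E} {L : ℝ → E →L[ℝ] E} (B : E →L[ℝ] E →L[ℝ] E) {T : ℝ}
    (hc : ContinuousOn c (Icc 0 T)) (hL : ContinuousOn L (Icc 0 T)) :
    IsLocLip (fun t x ↦ c t + L t x + B x x) T where
  continuousOn x := (hc.add (hL.clm_apply continuousOn_const)).add continuousOn_const
  lipschitzOnWith R := by
    obtain ⟨M, hM⟩ := isCompact_Icc.exists_bound_of_continuousOn hL
    set R' := max R 0
    refine ⟨Real.toNNReal (max M 0 + 2 * ‖B‖ * R'), fun t ht ↦ ?_⟩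
    refine LipschitzOnWith.of_dist_le_mul fun x hx y hy ↦ ?_
    rw [mem_closedBall_zero_iff] at hx hy
    rw [dist_eq_norm, dist_eq_norm]
    have e : c t + L t x + B x x - (c t + L t y + B y y) =
        L t (x - y) + B x (x - y) + B (x - y) y := by
      simp only [map_sub, sub_apply]
      abel
    rw [e]
    refine (norm_add₃_le).trans ?_
    have h1 : ‖L t (x - y)‖ ≤ max M 0 * ‖x - y‖ :=
      (L t).le_of_opNorm_le ((hM t ht).trans (le_max_left _ _)) _
    have h2 : ‖B x (x - y)‖ ≤ ‖B‖ * R' * ‖x - y‖ :=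
      (B.le_opNorm₂ _ _).trans (by gcongr; exact hx.trans (le_max_left _ _))
    have h3 : ‖B (x - y) y‖ ≤ ‖B‖ * R' * ‖x - y‖ := by
      refine (B.le_opNorm₂ _ _).trans ?_
      rw [mul_right_comm]
      gcongr
      exact hy.trans (le_max_left _ _)
    rw [Real.coe_toNNReal _ (by positivity)]
    linarith

end ODE

open FourierTransform TemperedDistribution
open scoped ComplexConjugate

/-! ### The operator `(1 - ∂ₓ²/6)⁻¹` on tempered distributions -/

/-- The symbol of `∂ₓ`. -/
def derivSymbol (ξ : ℝ) : ℂ := (2 * Real.pi * Complex.I) * (ξ : ℂ)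

/-- The symbol of `(1 - ∂ₓ²/6)⁻¹`. -/
def helmholtzSymbol (ξ : ℝ) : ℂ := ((1 + ‖(2 * Real.pi / √6) • ξ‖ ^ 2) ^ (-1 : ℝ) : ℝ)

@[fun_prop]
theorem hasTemperateGrowth_derivSymbol : derivSymbol.HasTemperateGrowth := by
  unfold derivSymbol
  fun_prop

@[fun_prop]
theorem hasTemperateGrowth_helmholtzSymbol : helmholtzSymbol.HasTemperateGrowth := by
  -- The symbol is the Bessel weight of exponent `-1` composed with a dilation, so its temperate
  -- growth is inherited.
  have h := (Function.hasTemperateGrowth_one_add_norm_sq_rpow ℝ (-1)).comp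
    ((2 * Real.pi / √6) • ContinuousLinearMap.id ℝ ℝ).hasTemperateGrowth
  exact Function.Complex.hasTemperateGrowth_ofReal.comp h

theorem helmholtzSymbol_eq (ξ : ℝ) :
    helmholtzSymbol ξ = (((1 + (2 * Real.pi) ^ 2 / 6 * ξ ^ 2)⁻¹ : ℝ) : ℂ) := by
  rw [helmholtzSymbol, Real.rpow_neg_one, norm_smul, Real.norm_eq_abs, Real.norm_eq_abs, mul_pow,
    sq_abs, sq_abs, div_pow, Real.sq_sqrt (by norm_num)]

theorem symbol_identity :
    (fun ξ ↦ 1 - (1 / 6 : ℂ) * (derivSymbol ξ * derivSymbol ξ)) * helmholtzSymbol = fun _ ↦ 1 := by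
  ext ξ
  have h : (1 + (2 * Real.pi) ^ 2 / 6 * ξ ^ 2 : ℝ) ≠ 0 := by positivity
  have e : 1 - (1 / 6 : ℂ) * (derivSymbol ξ * derivSymbol ξ) =
      ((1 + (2 * Real.pi) ^ 2 / 6 * ξ ^ 2 : ℝ) : ℂ) := by
    simp only [derivSymbol]
    push_cast
    linear_combination (-(1 / 6 : ℂ) * (2 * Real.pi) ^ 2 * ξ ^ 2) * Complex.I_sq
  rw [Pi.mul_apply, e, helmholtzSymbol_eq, ← Complex.ofReal_mul, mul_inv_cancel₀ h,
    Complex.ofReal_one]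

theorem dx_eq_lineDeriv (T : 𝓢'(ℝ, ℂ)) : dx T = LineDeriv.lineDerivOp (1 : ℝ) T := by
  ext φ
  rw [derivCLM_apply_apply, lineDerivOp_apply_apply]
  congr 2

theorem dx_eq_fourierMultiplier (T : 𝓢'(ℝ, ℂ)) :
    dx T = fourierMultiplierCLM ℂ derivSymbol T := by
  have h : derivSymbol = (2 * Real.pi * Complex.I) • (fun x : ℝ ↦ (x : ℂ)) := rfl
  rw [dx_eq_lineDeriv, lineDeriv_eq_fourierMultiplierCLM, h,
    fourierMultiplierCLM_smul (by fun_prop)]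
  simp

/-- The operator `(1 - ∂ₓ²/6)⁻¹` on tempered distributions. -/
def helmholtzInv : 𝓢'(ℝ, ℂ) →L[ℂ] 𝓢'(ℝ, ℂ) := fourierMultiplierCLM ℂ helmholtzSymbol

/-- The operator `1 - ∂ₓ²/6` on tempered distributions. -/
def helmholtz : 𝓢'(ℝ, ℂ) →L[ℂ] 𝓢'(ℝ, ℂ) :=
  ContinuousLinearMap.id ℂ _ - (1 / 6 : ℂ) • dx ∘L dx

theorem helmholtz_apply (T : 𝓢'(ℝ, ℂ)) : helmholtz T = T - (1 / 6 : ℂ) • dx (dx T) := rfl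

theorem helmholtz_eq_fourierMultiplier (T : 𝓢'(ℝ, ℂ)) : helmholtz T =
    fourierMultiplierCLM ℂ (fun ξ ↦ 1 - (1 / 6 : ℂ) * (derivSymbol ξ * derivSymbol ξ)) T := by
  rw [helmholtz_apply, dx_eq_fourierMultiplier, dx_eq_fourierMultiplier,
    fourierMultiplierCLM_fourierMultiplierCLM_apply (by fun_prop) (by fun_prop)]
  have h : (fun ξ ↦ 1 - (1 / 6 : ℂ) * (derivSymbol ξ * derivSymbol ξ)) =
      (fun _ ↦ 1) - (1 / 6 : ℂ) • (derivSymbol * derivSymbol) := rfl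
  have h1 : (derivSymbol * derivSymbol).HasTemperateGrowth := by
    apply Function.HasTemperateGrowth.mul <;> fun_prop
  have h2 : ((1 / 6 : ℂ) • (derivSymbol * derivSymbol)).HasTemperateGrowth :=
    (Function.HasTemperateGrowth.const (1 / 6 : ℂ)).smul h1
  rw [h, fourierMultiplierCLM_apply, fourierMultiplierCLM_apply, smulLeftCLM_sub (by fun_prop) h2,
    smulLeftCLM_smul h1]
  simp only [sub_apply, smul_apply, smulLeftCLM_const, one_smul]
  have hinv (S : 𝓢'(ℝ, ℂ)) : 𝓕⁻ S = fourierInvCLM ℂ 𝓢'(ℝ, ℂ) S := rfl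
  rw [hinv, hinv, map_sub, map_smul, ← hinv, ← hinv, fourierInv_fourier_eq]

theorem hasTemperateGrowth_helmholtz :
    (fun ξ ↦ 1 - (1 / 6 : ℂ) * (derivSymbol ξ * derivSymbol ξ)).HasTemperateGrowth := by
  fun_prop

theorem helmholtzInv_helmholtz (T : 𝓢'(ℝ, ℂ)) : helmholtzInv (helmholtz T) = T := by
  rw [helmholtz_eq_fourierMultiplier, helmholtzInv,
    fourierMultiplierCLM_fourierMultiplierCLM_apply hasTemperateGrowth_helmholtz (by fun_prop),
    symbol_identity]
  simp

theorem helmholtz_helmholtzInv (T : 𝓢'(ℝ, ℂ)) : helmholtz (helmholtzInv T) = T := by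
  rw [helmholtz_eq_fourierMultiplier, helmholtzInv,
    fourierMultiplierCLM_fourierMultiplierCLM_apply (by fun_prop) hasTemperateGrowth_helmholtz,
    mul_comm, symbol_identity]
  simp

theorem helmholtz_injective : Function.Injective helmholtz :=
  Function.LeftInverse.injective helmholtzInv_helmholtz

/-! ### Real distributions -/

/-- Complex conjugation of Schwartz functions. -/
def conjSchwartz : 𝓢(ℝ, ℂ) →L[ℝ] 𝓢(ℝ, ℂ) := SchwartzMap.postcompCLM (Complex.conjCLE : ℂ →L[ℝ] ℂ)

@[simp]
theorem conjSchwartz_apply (φ : 𝓢(ℝ, ℂ)) (x : ℝ) : conjSchwartz φ x = conj (φ x) := rfl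

theorem conjSchwartz_smul (c : ℂ) (φ : 𝓢(ℝ, ℂ)) :
    conjSchwartz (c • φ) = conj c • conjSchwartz φ := by
  ext x
  simp

theorem derivCLM_conjSchwartz (φ : 𝓢(ℝ, ℂ)) :
    SchwartzMap.derivCLM ℂ ℂ (conjSchwartz φ) = conjSchwartz (SchwartzMap.derivCLM ℂ ℂ φ) := by
  ext x
  rw [SchwartzMap.derivCLM_apply, conjSchwartz_apply, SchwartzMap.derivCLM_apply]
  exact ((Complex.conjCLE : ℂ →L[ℝ] ℂ).hasFDerivAt.comp_hasDerivAt x (φ.hasDerivAt x)).deriv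

/-- The complex conjugate of a tempered distribution. -/
def conjDist (T : 𝓢'(ℝ, ℂ)) : 𝓢'(ℝ, ℂ) :=
  ContinuousLinearMap.toPointwiseConvergenceCLM _ _ _ _
    { toFun := fun φ ↦ conj (T (conjSchwartz φ))
      map_add' := fun φ ψ ↦ by simp
      map_smul' := fun c φ ↦ by simp [conjSchwartz_smul]
      cont := Complex.continuous_conj.comp (T.continuous.comp conjSchwartz.continuous) }

@[simp]
theorem conjDist_apply (T : 𝓢'(ℝ, ℂ)) (φ : 𝓢(ℝ, ℂ)) :
    conjDist T φ = conj (T (conjSchwartz φ)) := rfl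

/-- A tempered distribution is real if it is its own complex conjugate. -/
def IsReal (T : 𝓢'(ℝ, ℂ)) : Prop := conjDist T = T

theorem conjDist_sub (S T : 𝓢'(ℝ, ℂ)) : conjDist (S - T) = conjDist S - conjDist T := by
  ext φ
  simp

theorem conjDist_smul (c : ℂ) (T : 𝓢'(ℝ, ℂ)) : conjDist (c • T) = conj c • conjDist T := by
  ext φ
  simp

theorem conjDist_dx (T : 𝓢'(ℝ, ℂ)) : conjDist (dx T) = dx (conjDist T) := by
  ext φ
  simp [derivCLM_conjSchwartz]

theorem IsReal.dx {T : 𝓢'(ℝ, ℂ)} (h : IsReal T) : IsReal (dx T) := by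
  rw [IsReal, conjDist_dx, h]

/-- The differential operator `1 - ∂ₓ²/6` has real coefficients and so commutes with conjugation.
Injectivity transfers this to the inverse without looking at the Fourier side. -/
theorem IsReal.helmholtzInv {T : 𝓢'(ℝ, ℂ)} (h : IsReal T) : IsReal (helmholtzInv T) := by
  apply helmholtz_injective
  have : BBM.helmholtz (conjDist (BBM.helmholtzInv T)) =
      conjDist (BBM.helmholtz (BBM.helmholtzInv T)) := by
    rw [helmholtz_apply, helmholtz_apply, conjDist_sub, conjDist_smul, conjDist_dx, conjDist_dx]
    simp [map_ofNat]
  rw [this, helmholtz_helmholtzInv, h]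

theorem coeFn_toComplex {p : ℝ≥0∞} [Fact (1 ≤ p)] (f : Lp ℝ p (volume : Measure ℝ)) :
    toComplex p f =ᵐ[volume] fun x ↦ (f x : ℂ) :=
  Complex.ofRealCLM.coeFn_compLpL f

theorem toDist_apply {p : ℝ≥0∞} [Fact (1 ≤ p)] (f : Lp ℝ p (volume : Measure ℝ)) (φ : 𝓢(ℝ, ℂ)) :
    toDist f φ = ∫ x, φ x * (f x : ℂ) := by
  change (toComplex p f : 𝓢'(ℝ, ℂ)) φ = _
  rw [Lp.toTemperedDistribution_apply]
  apply integral_congr_ae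
  filter_upwards [coeFn_toComplex f] with x hx
  rw [hx, smul_eq_mul]

theorem isReal_toDist {p : ℝ≥0∞} [Fact (1 ≤ p)] (f : Lp ℝ p (volume : Measure ℝ)) :
    IsReal (toDist f) := by
  ext φ
  rw [conjDist_apply, toDist_apply, toDist_apply, ← integral_conj]
  simp

theorem exists_toDist_eq {p : ℝ≥0∞} [Fact (1 ≤ p)] {f : Lp ℂ p (volume : Measure ℝ)}
    (h : IsReal (Lp.toTemperedDistributionCLM ℂ volume p f)) :
    ∃ g : Lp ℝ p (volume : Measure ℝ), toComplex p g = f := by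
  have h1 : (Complex.conjCLE : ℂ →L[ℝ] ℂ).compLpL p volume f = f := by
    apply LinearMap.ker_eq_bot.mp
      (Lp.ker_toTemperedDistributionCLM_eq_bot (F := ℂ) (μ := (volume : Measure ℝ)) (p := p))
    refine Eq.trans ?_ h
    ext φ
    simp only [ContinuousLinearMap.coe_coe, conjDist_apply, Lp.toTemperedDistributionCLM_apply,
      Lp.toTemperedDistribution_apply]
    rw [← integral_conj]
    apply integral_congr_ae
    filter_upwards [(Complex.conjCLE : ℂ →L[ℝ] ℂ).coeFn_compLpL (p := p) f] with x hx
    rw [hx]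
    simp
  refine ⟨Complex.reCLM.compLpL p volume f, ?_⟩
  apply Lp.ext
  have h2 := (Complex.conjCLE : ℂ →L[ℝ] ℂ).coeFn_compLpL (p := p) f
  rw [h1] at h2
  filter_upwards [coeFn_toComplex (Complex.reCLM.compLpL p volume f),
    Complex.reCLM.coeFn_compLpL (p := p) f, h2] with x hx hx' hx2
  rw [hx, hx']
  exact Complex.conj_eq_iff_re.1 hx2.symm

/-! ### The spaces `Hˢ` -/

theorem norm_toComplex {p : ℝ≥0∞} [Fact (1 ≤ p)] (f : Lp ℝ p (volume : Measure ℝ)) :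
    ‖toComplex p f‖ = ‖f‖ := by
  rw [Lp.norm_def, Lp.norm_def]
  congr 1
  apply eLpNorm_congr_norm_ae
  filter_upwards [coeFn_toComplex f] with x hx
  rw [hx, Complex.norm_real]

theorem Hs.norm_eq {s : ℝ} (u : Hs s) : ‖u‖ = ‖Hs.bessel u‖ := rfl

theorem Hs.isReal_toDist {s : ℝ} (u : Hs s) : IsReal u.toDist := BBM.isReal_toDist _

theorem Hs.toDist_injective {s : ℝ} : Function.Injective (Hs.toDist (s := s)) :=
  fun _ _ h ↦ Subtype.ext (BBM.toDist_injective h)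

/-- Because `s ≥ 0`, such a `T` is already an `L²` function, and reality lets it be taken
real-valued. All elements of `Hˢ` are constructed through this criterion. -/
theorem exists_Hs_of_besselPotential_eq {s : ℝ} (hs : 0 ≤ s) {T : 𝓢'(ℝ, ℂ)} (hT : IsReal T)
    {g : Lp ℂ 2 (volume : Measure ℝ)}
    (h : besselPotential ℝ ℂ s T = Lp.toTemperedDistributionCLM ℂ volume 2 g) :
    ∃ u : Hs s, u.toDist = T ∧ Hs.bessel u = g := by
  have hmem : MemSobolev s 2 T := ⟨g, h⟩
  obtain ⟨f, hf⟩ := memSobolev_zero_iff.1 (hmem.mono hs)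
  obtain ⟨f', rfl⟩ := exists_toDist_eq (f := f) (by
    rw [Lp.toTemperedDistributionCLM_apply, ← hf]; exact hT)
  have hf' : toDist f' = T := hf.symm
  let u : Hs s := ⟨f', show MemSobolev s 2 (toDist f') by rwa [hf']⟩
  have hu : u.toDist = T := hf'
  refine ⟨u, hu, Lp_toTemperedDistribution_injective ?_⟩
  rw [← Hs.bessel_spec, hu, h]

/-- Since `Hˢ` embeds in distributions, linearity of the lifted map is automatic. Only a pointwise
norm bound has to be supplied for each operator. -/
theorem exists_clm_Hs {X : Type*} [SeminormedAddCommGroup X] [NormedSpace ℝ X] {s : ℝ} (hs : 0 ≤ s)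
    (A : X →ₗ[ℝ] 𝓢'(ℝ, ℂ)) (hA : ∀ x, IsReal (A x)) (C : ℝ)
    (h : ∀ x, ∃ g : Lp ℂ 2 (volume : Measure ℝ),
      besselPotential ℝ ℂ s (A x) = Lp.toTemperedDistributionCLM ℂ volume 2 g ∧ ‖g‖ ≤ C * ‖x‖) :
    ∃ L : X →L[ℝ] Hs s, (∀ x, (L x).toDist = A x) ∧ ∀ x, ‖L x‖ ≤ C * ‖x‖ := by
  have h' : ∀ x, ∃ u : Hs s, u.toDist = A x ∧ ‖u‖ ≤ C * ‖x‖ := by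
    intro x
    obtain ⟨g, hg, hg'⟩ := h x
    obtain ⟨u, hu, hu'⟩ := exists_Hs_of_besselPotential_eq hs (hA x) hg
    exact ⟨u, hu, by rwa [u.norm_eq, hu']⟩
  choose F hF hF' using h'
  let L : X →ₗ[ℝ] Hs s :=
    { toFun := F
      map_add' := fun x y ↦ Hs.toDist_injective (by rw [map_add, hF, hF, hF, map_add])
      map_smul' := fun c x ↦ Hs.toDist_injective (by
        rw [RingHom.id_apply, map_smul, hF, hF, map_smul]) }
  exact ⟨L.mkContinuous C hF', hF, hF'⟩

theorem besselPotential_fourierMultiplier {m : ℝ → ℂ} (hm : m.HasTemperateGrowth) (s : ℝ)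
    (T : 𝓢'(ℝ, ℂ)) : besselPotential ℝ ℂ s (fourierMultiplierCLM ℂ m T) =
      fourierMultiplierCLM ℂ m (besselPotential ℝ ℂ s T) := by
  rw [besselPotential, fourierMultiplierCLM_fourierMultiplierCLM_apply hm (by fun_prop),
    fourierMultiplierCLM_fourierMultiplierCLM_apply (by fun_prop) hm, mul_comm]

theorem fourierMultiplier_toLp {m : ℝ → ℂ} (hm : m.HasTemperateGrowth)
    (hmem : MemLp m ∞ (volume : Measure ℝ)) (f : Lp ℂ 2 (volume : Measure ℝ)) :
    fourierMultiplierCLM ℂ m (Lp.toTemperedDistributionCLM ℂ volume 2 f) =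
      Lp.toTemperedDistributionCLM ℂ volume 2
        (𝓕⁻ (hmem.toLp m • 𝓕 f : Lp ℂ 2 (volume : Measure ℝ))) := by
  rw [fourierMultiplierCLM_apply, Lp.toTemperedDistributionCLM_apply,
    Lp.toTemperedDistributionCLM_apply, ← Lp.fourierInv_toTemperedDistribution_eq,
    Lp.toTemperedDistribution_smul_eq hm, Lp.fourier_toTemperedDistribution_eq]

theorem norm_fourierInv (f : Lp ℂ 2 (volume : Measure ℝ)) :
    ‖(𝓕⁻ f : Lp ℂ 2 (volume : Measure ℝ))‖ = ‖f‖ := by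
  rw [← Lp.norm_fourier_eq, fourier_fourierInv_eq]

theorem norm_toLp_top_le {f : ℝ → ℂ} (hf : MemLp f ∞ (volume : Measure ℝ)) {C : ℝ} (hC0 : 0 ≤ C)
    (hC : ∀ x, ‖f x‖ ≤ C) : ‖hf.toLp f‖ ≤ C := by
  rw [Lp.norm_toLp]
  refine ENNReal.toReal_le_of_le_ofReal hC0 ?_
  rw [eLpNorm_exponent_top]
  exact eLpNormEssSup_le_of_ae_bound (Eventually.of_forall hC)

/-- A bounded Fourier multiplier is bounded on `L²`. -/
theorem exists_fourierMultiplier_eq {m : ℝ → ℂ} (hm : m.HasTemperateGrowth) {C : ℝ}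
    (hC : ∀ ξ, ‖m ξ‖ ≤ C) (f : Lp ℂ 2 (volume : Measure ℝ)) :
    ∃ g : Lp ℂ 2 (volume : Measure ℝ),
      fourierMultiplierCLM ℂ m (Lp.toTemperedDistributionCLM ℂ volume 2 f) =
        Lp.toTemperedDistributionCLM ℂ volume 2 g ∧ ‖g‖ ≤ C * ‖f‖ := by
  have hC0 : 0 ≤ C := (norm_nonneg _).trans (hC 0)
  have hmem : MemLp m ∞ (volume : Measure ℝ) :=
    memLp_top_of_bound hm.1.continuous.aestronglyMeasurable C (Eventually.of_forall hC)
  refine ⟨_, fourierMultiplier_toLp hm hmem f, ?_⟩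
  rw [norm_fourierInv]
  refine (Lp.norm_smul_le _ _).trans ?_
  rw [Lp.norm_fourier_eq]
  gcongr
  exact norm_toLp_top_le hmem hC0 hC

/-- The Bessel potential is an isometry into `L²(ℝ; ℂ)`, so a limit `g` exists there. What needs
proof is that `J⁻ˢ g` is real, and this passes to the limit by testing against Schwartz functions.
-/
theorem completeSpace_Hs {s : ℝ} (hs : 0 ≤ s) : CompleteSpace (Hs s) := by
  refine Metric.complete_of_cauchySeq_tendsto fun u hu ↦ ?_
  have hiso : Isometry (Hs.bessel (s := s)) :=
    AddMonoidHomClass.isometry_of_norm (Hs.bessel (s := s)) fun u ↦ rfl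
  obtain ⟨g, hg⟩ := cauchySeq_tendsto_of_complete (hiso.uniformContinuous.comp_cauchySeq hu)
  set T := besselPotential ℝ ℂ (-s) (Lp.toTemperedDistributionCLM ℂ volume 2 g) with hT
  have hun : ∀ n, (u n).toDist =
      besselPotential ℝ ℂ (-s) (Lp.toTemperedDistributionCLM ℂ volume 2 (Hs.bessel (u n))) := by
    intro n
    rw [← Hs.bessel_spec, besselPotential_besselPotential_apply]
    simp
  have htend : Tendsto (fun n ↦ (u n).toDist) atTop (𝓝 T) := by
    simp only [hun]
    exact (((besselPotential ℝ ℂ (-s)).continuous.comp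
      (Lp.toTemperedDistributionCLM ℂ volume 2).continuous).tendsto g).comp hg
  have heval (φ : 𝓢(ℝ, ℂ)) : Tendsto (fun n ↦ (u n).toDist φ) atTop (𝓝 (T φ)) :=
    ((PointwiseConvergenceCLM.evalCLM (RingHom.id ℂ) ℂ φ).continuous.tendsto T).comp htend
  have hreal : IsReal T := by
    ext φ
    refine tendsto_nhds_unique
      ((Complex.continuous_conj.tendsto _).comp (heval (conjSchwartz φ))) ?_
    refine (heval φ).congr fun n ↦ ?_
    conv_lhs => rw [← (u n).isReal_toDist]
    rfl
  obtain ⟨v, -, hv⟩ := exists_Hs_of_besselPotential_eq hs hreal (g := g) (by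
    rw [hT, besselPotential_besselPotential_apply]; simp)
  refine ⟨v, ?_⟩
  rw [hiso.isUniformInducing.isInducing.tendsto_nhds_iff, hv]
  exact hg

theorem exists_inclusion {r s : ℝ} (hr : 0 ≤ r) (h : r ≤ s) : ∃ L : Hs s →L[ℝ] Hs r,
    (∀ u, (L u).toDist = u.toDist) ∧ ∀ u, ‖L u‖ ≤ 1 * ‖u‖ := by
  refine exists_clm_Hs hr Hs.toDist Hs.isReal_toDist 1 fun u ↦ ?_
  have e : besselPotential ℝ ℂ r u.toDist = besselPotential ℝ ℂ (r - s)
      (Lp.toTemperedDistributionCLM ℂ volume 2 (Hs.bessel u)) := by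
    rw [← Hs.bessel_spec, besselPotential_besselPotential_apply]
    congr 2
    ring
  rw [e]
  refine exists_fourierMultiplier_eq (by fun_prop) (fun ξ ↦ ?_) (Hs.bessel u)
  rw [Complex.norm_real, Real.norm_of_nonneg (by positivity)]
  exact Real.rpow_le_one_of_one_le_of_nonpos (by simp [sq_nonneg]) (by linarith)

/-- The inclusion `Hˢ ⊆ Hʳ` for `0 ≤ r ≤ s`. -/
def inclusion {r s : ℝ} (hr : 0 ≤ r) (h : r ≤ s) : Hs s →L[ℝ] Hs r := (exists_inclusion hr h).choose

@[simp]
theorem inclusion_toDist {r s : ℝ} (hr : 0 ≤ r) (h : r ≤ s) (u : Hs s) :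
    (inclusion hr h u).toDist = u.toDist := (exists_inclusion hr h).choose_spec.1 u

@[simp]
theorem inclusion_toL2 {r s : ℝ} (hr : 0 ≤ r) (h : r ≤ s) (u : Hs s) :
    (inclusion hr h u).toL2 = u.toL2 := toDist_injective (inclusion_toDist hr h u)

theorem norm_inclusion_le {r s : ℝ} (hr : 0 ≤ r) (h : r ≤ s) (u : Hs s) :
    ‖inclusion hr h u‖ ≤ ‖u‖ :=
  ((exists_inclusion hr h).choose_spec.2 u).trans_eq (one_mul _)

theorem norm_Hs_zero (u : Hs 0) : ‖u‖ = ‖u.toL2‖ := by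
  have h := u.bessel_spec
  rw [besselPotential_zero] at h
  have h1 : toComplex 2 u.toL2 = Hs.bessel u := Lp_toTemperedDistribution_injective h
  rw [u.norm_eq, ← h1, norm_toComplex]

theorem Hs.norm_toL2_le {s : ℝ} (hs : 0 ≤ s) (u : Hs s) : ‖u.toL2‖ ≤ ‖u‖ := by
  rw [← inclusion_toL2 le_rfl hs, ← norm_Hs_zero]
  exact norm_inclusion_le le_rfl hs u

theorem exists_ofL2 : ∃ L : Lp ℝ 2 (volume : Measure ℝ) →L[ℝ] Hs 0,
    (∀ f, (L f).toDist = toDist f) ∧ ∀ f, ‖L f‖ ≤ 1 * ‖f‖ := by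
  refine exists_clm_Hs le_rfl (toDist (p := 2)) (fun f ↦ isReal_toDist f) 1
    fun f ↦ ⟨toComplex 2 f, ?_, ?_⟩
  · rw [besselPotential_zero]
    rfl
  · rw [norm_toComplex, one_mul]

/-- The inclusion `L² → H⁰`. -/
def ofL2 : Lp ℝ 2 (volume : Measure ℝ) →L[ℝ] Hs 0 := exists_ofL2.choose

@[simp]
theorem ofL2_toDist (f : Lp ℝ 2 (volume : Measure ℝ)) : (ofL2 f).toDist = toDist f :=
  exists_ofL2.choose_spec.1 f

@[simp]
theorem ofL2_toL2 (f : Lp ℝ 2 (volume : Measure ℝ)) : (ofL2 f).toL2 = f :=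
  toDist_injective (ofL2_toDist f)

/-- The inclusion `Hˢ → L²` as a continuous linear map. -/
def Hs.toL2L {s : ℝ} (hs : 0 ≤ s) : Hs s →L[ℝ] Lp ℝ 2 (volume : Measure ℝ) :=
  Hs.toL2.mkContinuous 1 fun u ↦ (u.norm_toL2_le hs).trans_eq (one_mul _).symm

/-! ### Bounds for the symbols and the resulting operators on `Hˢ` -/

theorem norm_helmholtzSymbol_le (ξ : ℝ) : ‖helmholtzSymbol ξ‖ ≤ 1 := by
  rw [helmholtzSymbol_eq, Complex.norm_real, Real.norm_of_nonneg (by positivity)]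
  exact inv_le_one_of_one_le₀ (by
    nlinarith [sq_nonneg ξ, sq_nonneg (2 * Real.pi),
      mul_nonneg (sq_nonneg (2 * Real.pi)) (sq_nonneg ξ)])

/-- The symbol decays like `1/|ξ|`. This is used twice: boundedness gives an operator on `Hˢ`, and
square integrability gives the bilinear estimate. -/
theorem norm_deriv_mul_helmholtzSymbol_le (ξ : ℝ) :
    ‖derivSymbol ξ * helmholtzSymbol ξ‖ ≤ 7 * (1 + ‖ξ‖ ^ 2) ^ (-1 / 2 : ℝ) := by
  set a : ℝ := 2 * Real.pi * |ξ| with ha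
  have hpi : 0 < Real.pi := Real.pi_pos
  have ha0 : 0 ≤ a := by positivity
  have e : ‖derivSymbol ξ * helmholtzSymbol ξ‖ = a * (1 + a ^ 2 / 6)⁻¹ := by
    rw [norm_mul, helmholtzSymbol_eq, Complex.norm_real, Real.norm_of_nonneg (by positivity),
      derivSymbol]
    simp only [norm_mul, Complex.norm_I, Complex.norm_real, Real.norm_eq_abs, ha, mul_pow, sq_abs]
    rw [abs_of_pos hpi]
    norm_num
    left
    ring
  rw [e, neg_div, Real.rpow_neg (by positivity), ← Real.sqrt_eq_rpow, ← div_eq_mul_inv,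
    ← div_eq_mul_inv, div_le_div_iff₀ (by positivity) (by positivity)]
  have h1 : √(1 + ‖ξ‖ ^ 2) ≤ 1 + |ξ| := by
    rw [Real.sqrt_le_left (by positivity), Real.norm_eq_abs]
    nlinarith [abs_nonneg ξ]
  have h2 : |ξ| ≤ a := by
    rw [ha]
    nlinarith [Real.pi_gt_three, abs_nonneg ξ]
  calc a * √(1 + ‖ξ‖ ^ 2) ≤ a * (1 + a) := by gcongr; linarith
    -- The constant must exceed 6 to absorb `a²`; with 7 the difference `a²/6 - a + 7` is positive.
    _ ≤ 7 * (1 + a ^ 2 / 6) := by nlinarith [sq_nonneg (a - 3)]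

theorem exists_helmholtzInv_Hs {s : ℝ} (hs : 0 ≤ s) : ∃ L : Hs s →L[ℝ] Hs s,
    (∀ u, (L u).toDist = helmholtzInv u.toDist) ∧ ∀ u, ‖L u‖ ≤ 1 * ‖u‖ := by
  refine exists_clm_Hs hs ((helmholtzInv.toLinearMap.restrictScalars ℝ) ∘ₗ Hs.toDist)
    (fun u ↦ u.isReal_toDist.helmholtzInv) 1 fun u ↦ ?_
  have e : besselPotential ℝ ℂ s (helmholtzInv u.toDist) = fourierMultiplierCLM ℂ helmholtzSymbol
      (Lp.toTemperedDistributionCLM ℂ volume 2 (Hs.bessel u)) := by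
    rw [← Hs.bessel_spec, helmholtzInv, besselPotential_fourierMultiplier (by fun_prop)]
  obtain ⟨g, hg, hg'⟩ := exists_fourierMultiplier_eq hasTemperateGrowth_helmholtzSymbol
    norm_helmholtzSymbol_le (Hs.bessel u)
  exact ⟨g, e.trans hg, hg'⟩

theorem helmholtzInv_dx_eq (T : 𝓢'(ℝ, ℂ)) : helmholtzInv (dx T) =
    fourierMultiplierCLM ℂ (fun ξ ↦ derivSymbol ξ * helmholtzSymbol ξ) T := by
  rw [dx_eq_fourierMultiplier, helmholtzInv,
    fourierMultiplierCLM_fourierMultiplierCLM_apply (by fun_prop) (by fun_prop)]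
  rfl

theorem exists_helmholtzInv_dx_Hs {s : ℝ} (hs : 0 ≤ s) : ∃ L : Hs s →L[ℝ] Hs s,
    (∀ u, (L u).toDist = helmholtzInv (dx u.toDist)) ∧ ∀ u, ‖L u‖ ≤ 7 * ‖u‖ := by
  refine exists_clm_Hs hs ((helmholtzInv ∘L dx).toLinearMap.restrictScalars ℝ ∘ₗ Hs.toDist)
    (fun u ↦ u.isReal_toDist.dx.helmholtzInv) 7 fun u ↦ ?_
  have e : besselPotential ℝ ℂ s (helmholtzInv (dx u.toDist)) =
      fourierMultiplierCLM ℂ (fun ξ ↦ derivSymbol ξ * helmholtzSymbol ξ)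
      (Lp.toTemperedDistributionCLM ℂ volume 2 (Hs.bessel u)) := by
    rw [← Hs.bessel_spec, helmholtzInv_dx_eq, besselPotential_fourierMultiplier (by fun_prop)]
  obtain ⟨g, hg, hg'⟩ := exists_fourierMultiplier_eq
    (m := fun ξ ↦ derivSymbol ξ * helmholtzSymbol ξ) (C := 7) (by fun_prop) (fun ξ ↦ by
      refine (norm_deriv_mul_helmholtzSymbol_le ξ).trans (mul_le_of_le_one_right (by norm_num) ?_)
      exact Real.rpow_le_one_of_one_le_of_nonpos (by simp [sq_nonneg]) (by norm_num)) (Hs.bessel u)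
  exact ⟨g, e.trans hg, hg'⟩

/-- The operator `(1 - ∂ₓ²/6)⁻¹` on `Hˢ`. -/
def helmholtzInvHs {s : ℝ} (hs : 0 ≤ s) : Hs s →L[ℝ] Hs s := (exists_helmholtzInv_Hs hs).choose

theorem helmholtzInvHs_toDist {s : ℝ} (hs : 0 ≤ s) (u : Hs s) :
    (helmholtzInvHs hs u).toDist = helmholtzInv u.toDist :=
  (exists_helmholtzInv_Hs hs).choose_spec.1 u

/-- The operator `(1 - ∂ₓ²/6)⁻¹ ∂ₓ` on `Hˢ`. -/
def helmholtzInvDxHs {s : ℝ} (hs : 0 ≤ s) : Hs s →L[ℝ] Hs s :=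
  (exists_helmholtzInv_dx_Hs hs).choose

theorem helmholtzInvDxHs_toDist {s : ℝ} (hs : 0 ≤ s) (u : Hs s) :
    (helmholtzInvDxHs hs u).toDist = helmholtzInv (dx u.toDist) :=
  (exists_helmholtzInv_dx_Hs hs).choose_spec.1 u

/-! ### The bilinear estimate -/

/-- The character `x ↦ e^{-2πixξ}`. -/
def fourierCharacter (ξ x : ℝ) : ℂ := Real.fourierChar (-(x * ξ))

theorem memLp_fourierCharacter (ξ : ℝ) : MemLp (fourierCharacter ξ) ∞ (volume : Measure ℝ) := by
  refine memLp_top_of_bound (Continuous.aestronglyMeasurable ?_) 1 (Eventually.of_forall fun x ↦ ?_)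
  · unfold fourierCharacter
    exact continuous_subtype_val.comp (Real.continuous_fourierChar.comp (by fun_prop))
  · exact (Circle.norm_coe _).le

/-- The Fourier transform of an integrable function, evaluated at `ξ`. -/
def fourierAt (ξ : ℝ) : Lp ℂ 1 (volume : Measure ℝ) →L[ℂ] ℂ :=
  (ContinuousLinearMap.mul ℂ ℂ).lpPairing volume ∞ 1 ((memLp_fourierCharacter ξ).toLp _)

theorem fourierAt_eq (ξ : ℝ) (f : Lp ℂ 1 (volume : Measure ℝ)) :
    fourierAt ξ f = 𝓕 (f : ℝ → ℂ) ξ := by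
  rw [fourierAt, ContinuousLinearMap.lpPairing_eq_integral, Real.fourier_real_eq]
  apply integral_congr_ae
  filter_upwards [(memLp_fourierCharacter ξ).coeFn_toLp] with x hx
  rw [hx]
  rfl

/-- Reflection in `L²`. -/
def reflection : Lp ℂ 2 (volume : Measure ℝ) →ₗᵢ[ℂ] Lp ℂ 2 (volume : Measure ℝ) :=
  Lp.compMeasurePreservingₗᵢ ℂ (fun x : ℝ ↦ -x) (Measure.measurePreserving_neg volume)

/-- Translation in `L²`. -/
def translation (ξ : ℝ) : Lp ℂ 2 (volume : Measure ℝ) →ₗᵢ[ℂ] Lp ℂ 2 (volume : Measure ℝ) :=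
  Lp.compMeasurePreservingₗᵢ ℂ (fun x : ℝ ↦ ξ + x) (measurePreserving_add_left volume ξ)

theorem coeFn_reflection (f : Lp ℂ 2 (volume : Measure ℝ)) :
    reflection f =ᵐ[volume] fun x ↦ f (-x) :=
  Lp.coeFn_compMeasurePreserving f (Measure.measurePreserving_neg volume)

theorem coeFn_translation (ξ : ℝ) (f : Lp ℂ 2 (volume : Measure ℝ)) :
    translation ξ f =ᵐ[volume] fun x ↦ f (ξ + x) :=
  Lp.coeFn_compMeasurePreserving f (measurePreserving_add_left volume ξ)

/-- This is the convolution theorem for the inverse transforms, read at `-ξ`. The reflected form `𝓕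
f (-y) * 𝓕 g (ξ + y)` makes the integral a pairing of a reflected and a translated function, both
isometric operations on `L²`. -/
theorem fourier_schwartz_mul (f g : 𝓢(ℝ, ℂ)) (ξ : ℝ) :
    𝓕 (fun x ↦ f x * g x) ξ = ∫ y, 𝓕 f (-y) * 𝓕 g (ξ + y) := by
  have h1 : 𝓕⁻ (SchwartzMap.pairing (ContinuousLinearMap.mul ℂ ℂ) f g) =
      SchwartzMap.convolution (ContinuousLinearMap.mul ℂ ℂ) (𝓕⁻ f) (𝓕⁻ g) := by
    have := SchwartzMap.fourier_convolution (ContinuousLinearMap.mul ℂ ℂ) (𝓕⁻ f) (𝓕⁻ g)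
    rw [fourier_fourierInv_eq, fourier_fourierInv_eq] at this
    rw [← this, fourierInv_fourier_eq]
  have h2 := congrArg (fun h : 𝓢(ℝ, ℂ) ↦ h (-ξ)) h1
  simp only [SchwartzMap.convolution_apply] at h2
  rw [SchwartzMap.fourierInv_coe, Real.fourierInv_eq_fourier_neg, neg_neg] at h2
  refine Eq.trans ?_ (h2.trans ?_)
  · rfl
  · rw [MeasureTheory.convolution]
    congr 1
    ext y
    rw [SchwartzMap.fourierInv_coe, SchwartzMap.fourierInv_coe, Real.fourierInv_eq_fourier_neg,
      Real.fourierInv_eq_fourier_neg, SchwartzMap.fourier_coe, SchwartzMap.fourier_coe,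
      ContinuousLinearMap.mul_apply']
    congr 2
    ring_nf

/-- The Fourier transform of a product of `L²` functions is the convolution of the Fourier
transforms. -/
theorem fourierAt_holder (F G : Lp ℂ 2 (volume : Measure ℝ)) (ξ : ℝ) :
    fourierAt ξ ((ContinuousLinearMap.mul ℂ ℂ).holderL volume 2 2 1 F G) =
      (ContinuousLinearMap.mul ℂ ℂ).lpPairing volume 2 2 (reflection (𝓕 F))
        (translation ξ (𝓕 G)) := by
  have hd := SchwartzMap.denseRange_toLpCLM (E := ℝ) (F := ℂ) (p := 2) ENNReal.ofNat_ne_top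
    (μ := (volume : Measure ℝ))
  have hF : Continuous (𝓕 : Lp ℂ 2 (volume : Measure ℝ) → Lp ℂ 2 (volume : Measure ℝ)) :=
    (Lp.fourierTransformₗᵢ ℝ ℂ).continuous
  -- Both sides are jointly continuous on `L² × L²`, so the identity only has to be checked for
  -- Schwartz functions.
  refine hd.induction_on₂ ?_ ?_ F G
  · apply isClosed_eq
    · fun_prop
    · have h1 := reflection.continuous
      have h2 := (translation ξ).continuous
      exact (((ContinuousLinearMap.mul ℂ ℂ).lpPairing volume 2 2).continuous.comp
        (h1.comp (hF.comp continuous_fst))).clm_apply (h2.comp (hF.comp continuous_snd))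
  · intro f g
    rw [SchwartzMap.toLpCLM_apply, SchwartzMap.toLpCLM_apply, SchwartzMap.toLp_fourier_eq,
      SchwartzMap.toLp_fourier_eq, fourierAt_eq, ContinuousLinearMap.lpPairing_eq_integral]
    trans 𝓕 (fun x ↦ f x * g x) ξ
    · rw [Real.fourier_real_eq, Real.fourier_real_eq]
      apply integral_congr_ae
      filter_upwards [(ContinuousLinearMap.mul ℂ ℂ).coeFn_holder (r := 1) (f.toLp 2) (g.toLp 2),
        f.coeFn_toLp 2, g.coeFn_toLp 2] with x hx hf hg
      rw [ContinuousLinearMap.holderL_apply_apply, hx, hf, hg]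
      rfl
    · rw [fourier_schwartz_mul]
      apply integral_congr_ae
      filter_upwards [coeFn_reflection ((𝓕 f).toLp 2), coeFn_translation ξ ((𝓕 g).toLp 2),
        (Measure.measurePreserving_neg (volume : Measure ℝ)).quasiMeasurePreserving.ae_eq_comp
          ((𝓕 f).coeFn_toLp 2),
        (measurePreserving_add_left (volume : Measure ℝ) ξ).quasiMeasurePreserving.ae_eq_comp
          ((𝓕 g).coeFn_toLp 2)] with y h1 h2 h3 h4
      simp only [Function.comp_apply] at h3 h4
      rw [h1, h2, h3, h4]
      rfl

theorem integrable_norm_mul_norm (F G : Lp ℂ 2 (volume : Measure ℝ)) :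
    Integrable (fun x ↦ ‖F x‖ * ‖G x‖) := by
  have := L1.integrable_coeFn ((ContinuousLinearMap.mul ℂ ℂ).holder 1 F G)
  refine this.norm.congr ?_
  filter_upwards [(ContinuousLinearMap.mul ℂ ℂ).coeFn_holder (r := 1) F G] with x hx
  rw [hx]
  simp

theorem integral_norm_mul_norm_le (F G : Lp ℂ 2 (volume : Measure ℝ)) :
    ∫ x, ‖F x‖ * ‖G x‖ ≤ ‖F‖ * ‖G‖ := by
  have h := (ContinuousLinearMap.mul ℂ ℂ).norm_holder_apply_apply_le (r := 1) F G
  rw [L1.norm_eq_integral_norm] at h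
  have h1 : ‖ContinuousLinearMap.mul ℂ ℂ‖ ≤ 1 := ContinuousLinearMap.opNorm_mul_le ℂ ℂ
  calc ∫ x, ‖F x‖ * ‖G x‖ = ∫ x, ‖(ContinuousLinearMap.mul ℂ ℂ).holder 1 F G x‖ := by
        apply integral_congr_ae
        filter_upwards [(ContinuousLinearMap.mul ℂ ℂ).coeFn_holder (r := 1) F G] with x hx
        rw [hx]
        simp
    _ ≤ ‖ContinuousLinearMap.mul ℂ ℂ‖ * ‖F‖ * ‖G‖ := h
    _ ≤ 1 * ‖F‖ * ‖G‖ := by gcongr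
    _ = ‖F‖ * ‖G‖ := by rw [one_mul]

theorem fourier_toComplex_ae_eq {s : ℝ} (hs : 0 ≤ s) (u : Hs s) :
    (𝓕 (toComplex 2 u.toL2) : Lp ℂ 2 (volume : Measure ℝ)) =ᵐ[volume]
      fun ξ ↦ (((1 + ‖ξ‖ ^ 2) ^ (-s / 2) : ℝ) : ℂ) *
        (𝓕 (Hs.bessel u) : Lp ℂ 2 (volume : Measure ℝ)) ξ := by
  have hm : (fun ξ : ℝ ↦ (((1 + ‖ξ‖ ^ 2) ^ (-s / 2) : ℝ) : ℂ)).HasTemperateGrowth := by fun_prop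
  have hmem : MemLp (fun ξ : ℝ ↦ (((1 + ‖ξ‖ ^ 2) ^ (-s / 2) : ℝ) : ℂ)) ∞ (volume : Measure ℝ) := by
    refine memLp_top_of_bound hm.1.continuous.aestronglyMeasurable 1
      (Eventually.of_forall fun ξ ↦ ?_)
    rw [Complex.norm_real, Real.norm_of_nonneg (by positivity)]
    exact Real.rpow_le_one_of_one_le_of_nonpos (by simp [sq_nonneg]) (by linarith)
  have h1 : toComplex 2 u.toL2 =
      𝓕⁻ (hmem.toLp _ • 𝓕 (Hs.bessel u) : Lp ℂ 2 (volume : Measure ℝ)) := by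
    apply Lp_toTemperedDistribution_injective
    rw [← fourierMultiplier_toLp hm, ← Hs.bessel_spec]
    change u.toDist = besselPotential ℝ ℂ (-s) _
    rw [besselPotential_besselPotential_apply]
    simp
  rw [h1, fourier_fourierInv_eq]
  filter_upwards [Lp.coeFn_lpSMul (r := 2) (hmem.toLp _) (𝓕 (Hs.bessel u)), hmem.coeFn_toLp]
    with ξ h2 h3
  rw [h2, Pi.smul_apply', h3, smul_eq_mul]

theorem japanese_bracket_le {s : ℝ} (hs : 0 ≤ s) (a b : ℝ) :
    (1 + ‖a + b‖ ^ 2) ^ (s / 2) ≤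
      4 ^ (s / 2) * ((1 + ‖a‖ ^ 2) ^ (s / 2) + (1 + ‖b‖ ^ 2) ^ (s / 2)) := by
  simp only [Real.norm_eq_abs, sq_abs]
  have hs2 : 0 ≤ s / 2 := by positivity
  rcases le_total (a ^ 2) (b ^ 2) with h | h
  · calc (1 + (a + b) ^ 2) ^ (s / 2) ≤ (4 * (1 + b ^ 2)) ^ (s / 2) :=
        Real.rpow_le_rpow (by positivity) (by nlinarith [sq_nonneg (a - b)]) hs2
      _ = 4 ^ (s / 2) * (1 + b ^ 2) ^ (s / 2) := Real.mul_rpow (by norm_num) (by positivity)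
      _ ≤ _ := by
        gcongr
        exact le_add_of_nonneg_left (by positivity)
  · calc (1 + (a + b) ^ 2) ^ (s / 2) ≤ (4 * (1 + a ^ 2)) ^ (s / 2) :=
        Real.rpow_le_rpow (by positivity) (by nlinarith [sq_nonneg (a - b)]) hs2
      _ = 4 ^ (s / 2) * (1 + a ^ 2) ^ (s / 2) := Real.mul_rpow (by norm_num) (by positivity)
      _ ≤ _ := by
        gcongr
        exact le_add_of_nonneg_right (by positivity)

/-- The weight at `ξ = -y + (ξ + y)` is bounded by the sum of the weights at the two frequencies.
Each weight is absorbed by one factor, turning it into its Bessel potential, and Cauchy–Schwarz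
finishes. Only one factor at a time carries the `Hˢ` norm, which makes the estimate tame. -/
theorem weighted_fourierAt_le {s : ℝ} (hs : 0 ≤ s) (u v : Hs s) (ξ : ℝ) :
    (1 + ‖ξ‖ ^ 2) ^ (s / 2) * ‖fourierAt ξ ((ContinuousLinearMap.mul ℂ ℂ).holderL volume 2 2 1
      (toComplex 2 u.toL2) (toComplex 2 v.toL2))‖ ≤
      4 ^ (s / 2) * (‖u‖ * ‖v.toL2‖ + ‖u.toL2‖ * ‖v‖) := by
  set U := reflection (𝓕 (toComplex 2 u.toL2)) with hU
  set V := translation ξ (𝓕 (toComplex 2 v.toL2)) with hV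
  set U' := reflection (𝓕 (Hs.bessel u)) with hU'
  set V' := translation ξ (𝓕 (Hs.bessel v)) with hV'
  have nU : ‖U‖ = ‖u.toL2‖ := by
    rw [hU, LinearIsometry.norm_map, Lp.norm_fourier_eq, norm_toComplex]
  have nV : ‖V‖ = ‖v.toL2‖ := by
    rw [hV, LinearIsometry.norm_map, Lp.norm_fourier_eq, norm_toComplex]
  have nU' : ‖U'‖ = ‖u‖ := by rw [hU', LinearIsometry.norm_map, Lp.norm_fourier_eq, u.norm_eq]
  have nV' : ‖V'‖ = ‖v‖ := by rw [hV', LinearIsometry.norm_map, Lp.norm_fourier_eq, v.norm_eq]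
  have hw : ∀ ζ : ℝ, (1 + ‖ζ‖ ^ 2) ^ (s / 2) * (1 + ‖ζ‖ ^ 2) ^ (-s / 2) = 1 := fun ζ ↦ by
    rw [← Real.rpow_add (by positivity), neg_div, add_neg_cancel, Real.rpow_zero]
  have hn : ∀ ζ : ℝ, ‖(1 + ‖ζ‖ ^ 2) ^ (-s / 2)‖ = (1 + ‖ζ‖ ^ 2) ^ (-s / 2) := fun ζ ↦
    Real.norm_of_nonneg (by positivity)
  have eU : ∀ᵐ y, (1 + ‖-y‖ ^ 2) ^ (s / 2) * ‖U y‖ = ‖U' y‖ := by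
    filter_upwards [coeFn_reflection (𝓕 (toComplex 2 u.toL2)), coeFn_reflection (𝓕 (Hs.bessel u)),
      (Measure.measurePreserving_neg (volume : Measure ℝ)).quasiMeasurePreserving.ae_eq_comp
        (fourier_toComplex_ae_eq hs u)] with y h1 h2 h3
    simp only [Function.comp_apply] at h3
    rw [hU, hU', h1, h2, h3, norm_mul, Complex.norm_real, hn, ← mul_assoc, hw, one_mul]
  have eV : ∀ᵐ y, (1 + ‖ξ + y‖ ^ 2) ^ (s / 2) * ‖V y‖ = ‖V' y‖ := by
    filter_upwards [coeFn_translation ξ (𝓕 (toComplex 2 v.toL2)),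
      coeFn_translation ξ (𝓕 (Hs.bessel v)),
      (measurePreserving_add_left (volume : Measure ℝ) ξ).quasiMeasurePreserving.ae_eq_comp
        (fourier_toComplex_ae_eq hs v)] with y h1 h2 h3
    simp only [Function.comp_apply] at h3
    rw [hV, hV', h1, h2, h3, norm_mul, Complex.norm_real, hn, ← mul_assoc, hw, one_mul]
  rw [fourierAt_holder, ContinuousLinearMap.lpPairing_eq_integral]
  have i1 := integrable_norm_mul_norm U V
  have i2 := integrable_norm_mul_norm U' V
  have i3 := integrable_norm_mul_norm U V'
  calc (1 + ‖ξ‖ ^ 2) ^ (s / 2) * ‖∫ y, ContinuousLinearMap.mul ℂ ℂ (U y) (V y)‖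
      ≤ (1 + ‖ξ‖ ^ 2) ^ (s / 2) * ∫ y, ‖U y‖ * ‖V y‖ := by
        gcongr
        refine (norm_integral_le_integral_norm _).trans_eq ?_
        simp
    _ = ∫ y, (1 + ‖ξ‖ ^ 2) ^ (s / 2) * (‖U y‖ * ‖V y‖) := (integral_const_mul _ _).symm
    _ ≤ ∫ y, 4 ^ (s / 2) * (‖U' y‖ * ‖V y‖ + ‖U y‖ * ‖V' y‖) := by
        refine integral_mono_ae (i1.const_mul _) ((i2.add i3).const_mul _) ?_
        filter_upwards [eU, eV] with y h1 h2
        have h3 := japanese_bracket_le hs (-y) (ξ + y)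
        rw [show -y + (ξ + y) = ξ by ring] at h3
        calc (1 + ‖ξ‖ ^ 2) ^ (s / 2) * (‖U y‖ * ‖V y‖) ≤
            4 ^ (s / 2) * ((1 + ‖-y‖ ^ 2) ^ (s / 2) + (1 + ‖ξ + y‖ ^ 2) ^ (s / 2)) *
              (‖U y‖ * ‖V y‖) := by gcongr
          _ = 4 ^ (s / 2) * (((1 + ‖-y‖ ^ 2) ^ (s / 2) * ‖U y‖) * ‖V y‖ +
              ‖U y‖ * ((1 + ‖ξ + y‖ ^ 2) ^ (s / 2) * ‖V y‖)) := by ring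
          _ = _ := by rw [h1, h2]
    _ = 4 ^ (s / 2) * ((∫ y, ‖U' y‖ * ‖V y‖) + ∫ y, ‖U y‖ * ‖V' y‖) := by
        rw [integral_const_mul, integral_add i2 i3]
    _ ≤ 4 ^ (s / 2) * (‖U'‖ * ‖V‖ + ‖U‖ * ‖V'‖) := by
        gcongr <;> exact integral_norm_mul_norm_le _ _
    _ = _ := by rw [nU, nV, nU', nV']

theorem coeFn_prod (f g : Lp ℝ 2 (volume : Measure ℝ)) :
    prod f g =ᵐ[volume] fun x ↦ f x * g x := by
  filter_upwards [Lp.coeFn_lpSMul (r := 1) f g] with x hx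
  exact hx

theorem toComplex_prod (f g : Lp ℝ 2 (volume : Measure ℝ)) : toComplex 1 (prod f g) =
    (ContinuousLinearMap.mul ℂ ℂ).holderL volume 2 2 1 (toComplex 2 f) (toComplex 2 g) := by
  apply Lp.ext
  filter_upwards [coeFn_toComplex (prod f g), coeFn_prod f g, coeFn_toComplex f, coeFn_toComplex g,
    (ContinuousLinearMap.mul ℂ ℂ).coeFn_holder (r := 1) (toComplex 2 f) (toComplex 2 g)]
    with x h1 h2 h3 h4 h5
  rw [h1, h2, ContinuousLinearMap.holderL_apply_apply, h5, h3, h4]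
  simp

theorem prod_add_left (f f' g : Lp ℝ 2 (volume : Measure ℝ)) :
    prod (f + f') g = prod f g + prod f' g := Lp.smul_add f f' g

theorem prod_add_right (f g g' : Lp ℝ 2 (volume : Measure ℝ)) :
    prod f (g + g') = prod f g + prod f g' := Lp.add_smul f g g'

theorem prod_smul_left (c : ℝ) (f g : Lp ℝ 2 (volume : Measure ℝ)) :
    prod (c • f) g = c • prod f g := Lp.smul_assoc c f g

theorem prod_smul_right (c : ℝ) (f g : Lp ℝ 2 (volume : Measure ℝ)) :
    prod f (c • g) = c • prod f g := (Lp.smul_comm c f g).symm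

theorem prod_comm (f g : Lp ℝ 2 (volume : Measure ℝ)) : prod f g = prod g f := by
  apply Lp.ext
  filter_upwards [coeFn_prod f g, coeFn_prod g f] with x h1 h2
  rw [h1, h2, mul_comm]

/-- The Fourier transform of an integrable function, as a distribution. -/
theorem fourier_toTemperedDistribution_one (f : Lp ℂ 1 (volume : Measure ℝ)) (φ : 𝓢(ℝ, ℂ)) :
    𝓕 (Lp.toTemperedDistributionCLM ℂ volume 1 f) φ = ∫ ξ, φ ξ * fourierAt ξ f := by
  rw [TemperedDistribution.fourier_apply, Lp.toTemperedDistributionCLM_apply,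
    Lp.toTemperedDistribution_apply]
  have h := VectorFourier.integral_fourierIntegral_smul_eq_flip (L := innerₗ ℝ)
    Real.continuous_fourierChar continuous_inner (φ.integrable (μ := volume))
    (L1.integrable_coeFn f)
  simp only [fourierAt_eq, flip_innerₗ] at h ⊢
  exact h

theorem continuous_fourierAt (f : Lp ℂ 1 (volume : Measure ℝ)) :
    Continuous fun ξ ↦ fourierAt ξ f := by
  simp only [fourierAt_eq]
  exact VectorFourier.fourierIntegral_continuous Real.continuous_fourierChar
    (by exact continuous_inner) (L1.integrable_coeFn f)

theorem memLp_deriv_mul_helmholtzSymbol :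
    MemLp (fun ξ ↦ derivSymbol ξ * helmholtzSymbol ξ) 2 (volume : Measure ℝ) := by
  have hm : (fun ξ ↦ derivSymbol ξ * helmholtzSymbol ξ).HasTemperateGrowth := by fun_prop
  rw [memLp_two_iff_integrable_sq_norm hm.1.continuous.aestronglyMeasurable]
  refine (integrable_inv_one_add_sq.const_mul 49).mono'
    (hm.1.continuous.norm.pow 2).aestronglyMeasurable (Eventually.of_forall fun ξ ↦ ?_)
  rw [Real.norm_of_nonneg (by positivity)]
  calc ‖derivSymbol ξ * helmholtzSymbol ξ‖ ^ 2 ≤ (7 * (1 + ‖ξ‖ ^ 2) ^ (-1 / 2 : ℝ)) ^ 2 := by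
        gcongr
        exact norm_deriv_mul_helmholtzSymbol_le ξ
    _ = 49 * (1 + ξ ^ 2)⁻¹ := by
        rw [mul_pow, ← Real.rpow_mul_natCast (by positivity), Real.norm_eq_abs, sq_abs,
          ← Real.rpow_neg_one]
        norm_num

/-- A smoothing multiplier in `L²` maps integrable functions with a weighted bound on the Fourier
transform to `Hˢ`. -/
theorem exists_besselPotential_helmholtzInv_dx {s : ℝ} (f : Lp ℂ 1 (volume : Measure ℝ)) {N : ℝ}
    (hN : ∀ ξ, (1 + ‖ξ‖ ^ 2) ^ (s / 2) * ‖fourierAt ξ f‖ ≤ N) :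
    ∃ g : Lp ℂ 2 (volume : Measure ℝ),
      besselPotential ℝ ℂ s (helmholtzInv (dx (Lp.toTemperedDistributionCLM ℂ volume 1 f))) =
        Lp.toTemperedDistributionCLM ℂ volume 2 g ∧
      ‖g‖ ≤ ‖memLp_deriv_mul_helmholtzSymbol.toLp‖ * N := by
  have hN0 : 0 ≤ N := (by positivity : (0 : ℝ) ≤ _).trans (hN 0)
  have hw : (fun ξ : ℝ ↦ (((1 + ‖ξ‖ ^ 2) ^ (s / 2) : ℝ) : ℂ)).HasTemperateGrowth := by fun_prop
  have hm : (fun ξ ↦ derivSymbol ξ * helmholtzSymbol ξ).HasTemperateGrowth := by fun_prop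
  set W : ℝ → ℂ := fun ξ ↦ (((1 + ‖ξ‖ ^ 2) ^ (s / 2) : ℝ) : ℂ) * fourierAt ξ f with hW
  have hWN : ∀ ξ, ‖W ξ‖ ≤ N := fun ξ ↦ by
    rw [hW, norm_mul, Complex.norm_real, Real.norm_of_nonneg (by positivity)]
    exact hN ξ
  have hWm : MemLp W ∞ (volume : Measure ℝ) :=
    memLp_top_of_bound (hw.1.continuous.mul (continuous_fourierAt f)).aestronglyMeasurable N
      (Eventually.of_forall hWN)
  have e : Lp.toTemperedDistribution (hWm.toLp W) =
      smulLeftCLM ℂ (fun ξ : ℝ ↦ (((1 + ‖ξ‖ ^ 2) ^ (s / 2) : ℝ) : ℂ))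
        (𝓕 (Lp.toTemperedDistributionCLM ℂ volume 1 f)) := by
    ext φ
    rw [smulLeftCLM_apply_apply, fourier_toTemperedDistribution_one,
      Lp.toTemperedDistribution_apply]
    apply integral_congr_ae
    filter_upwards [hWm.coeFn_toLp] with ξ hξ
    rw [hξ, SchwartzMap.smulLeftCLM_apply_apply hw, hW, smul_eq_mul, smul_eq_mul]
    ring
  refine ⟨𝓕⁻ (memLp_deriv_mul_helmholtzSymbol.toLp • hWm.toLp W : Lp ℂ 2 (volume : Measure ℝ)),
    ?_, ?_⟩
  · rw [helmholtzInv_dx_eq, Lp.toTemperedDistributionCLM_apply (p := 2),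
      ← Lp.fourierInv_toTemperedDistribution_eq, Lp.toTemperedDistribution_smul_eq hm, e,
      besselPotential, fourierMultiplierCLM_fourierMultiplierCLM_apply hm hw,
      smulLeftCLM_smulLeftCLM_apply hw hm, fourierMultiplierCLM_apply, mul_comm]
  · rw [norm_fourierInv]
    refine (Lp.norm_smul_le _ _).trans ?_
    gcongr
    exact norm_toLp_top_le hWm hN0 hWN

theorem exists_bilinear_aux {s : ℝ} (hs : 0 ≤ s) : ∃ C : ℝ, 0 ≤ C ∧ ∀ u v : Hs s, ∃ w : Hs s,
    w.toDist = helmholtzInv (dx (toDist (prod u.toL2 v.toL2))) ∧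
    ‖w‖ ≤ C * (‖u‖ * ‖v.toL2‖ + ‖u.toL2‖ * ‖v‖) := by
  -- The first factor is the `L²` norm of the multiplier, the second comes from splitting the
  -- weight.
  refine ⟨‖memLp_deriv_mul_helmholtzSymbol.toLp‖ * 4 ^ (s / 2), by positivity, fun u v ↦ ?_⟩
  obtain ⟨g, hg, hg'⟩ := exists_besselPotential_helmholtzInv_dx (s := s)
    (toComplex 1 (prod u.toL2 v.toL2)) (by
      rw [toComplex_prod]
      exact weighted_fourierAt_le hs u v)
  obtain ⟨w, hw, hw'⟩ := exists_Hs_of_besselPotential_eq hs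
    (isReal_toDist (prod u.toL2 v.toL2)).dx.helmholtzInv hg
  refine ⟨w, hw, ?_⟩
  rw [w.norm_eq, hw', mul_assoc]
  exact hg'

theorem exists_clm₂ {X Y Z : Type*} [NormedAddCommGroup X] [NormedSpace ℝ X]
    [NormedAddCommGroup Y] [NormedSpace ℝ Y] [NormedAddCommGroup Z] [NormedSpace ℝ Z]
    (F : X → Y → Z) (h₁ : ∀ x x' y, F (x + x') y = F x y + F x' y)
    (h₂ : ∀ (c : ℝ) x y, F (c • x) y = c • F x y) (h₃ : ∀ x y y', F x (y + y') = F x y + F x y')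
    (h₄ : ∀ (c : ℝ) x y, F x (c • y) = c • F x y) {C : ℝ} (hC : ∀ x y, ‖F x y‖ ≤ C * ‖x‖ * ‖y‖) :
    ∃ B : X →L[ℝ] Y →L[ℝ] Z, ∀ x y, B x y = F x y :=
  ⟨(LinearMap.mk₂ ℝ F h₁ h₂ h₃ h₄).mkContinuous₂ C hC, fun _ _ ↦ rfl⟩

/-- `(u, v) ↦ (1 - ∂ₓ²/6)⁻¹ ∂ₓ (u v)` is a bounded bilinear map of `Hˢ` with a tame estimate. -/
theorem exists_bilinear {s : ℝ} (hs : 0 ≤ s) : ∃ (B : Hs s →L[ℝ] Hs s →L[ℝ] Hs s) (C : ℝ),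
    (∀ u v, (B u v).toDist = helmholtzInv (dx (toDist (prod u.toL2 v.toL2)))) ∧
    ∀ u v, ‖B u v‖ ≤ C * (‖u‖ * ‖v.toL2‖ + ‖u.toL2‖ * ‖v‖) := by
  obtain ⟨C, hC0, h⟩ := exists_bilinear_aux hs
  choose F hF hF' using h
  have h₁ (u u' v : Hs s) : F (u + u') v = F u v + F u' v := Hs.toDist_injective <| by
    rw [Hs.toDist.map_add, hF, hF, hF, Hs.toL2.map_add, prod_add_left, toDist.map_add, dx.map_add,
      helmholtzInv.map_add]
  have h₂ (c : ℝ) (u v : Hs s) : F (c • u) v = c • F u v := Hs.toDist_injective <| by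
    rw [Hs.toDist.map_smul, hF, hF, Hs.toL2.map_smul, prod_smul_left, toDist.map_smul,
      dx.map_smul_of_tower, helmholtzInv.map_smul_of_tower]
  have h₃ (u v v' : Hs s) : F u (v + v') = F u v + F u v' := Hs.toDist_injective <| by
    rw [Hs.toDist.map_add, hF, hF, hF, Hs.toL2.map_add, prod_add_right, toDist.map_add, dx.map_add,
      helmholtzInv.map_add]
  have h₄ (c : ℝ) (u v : Hs s) : F u (c • v) = c • F u v := Hs.toDist_injective <| by
    rw [Hs.toDist.map_smul, hF, hF, Hs.toL2.map_smul, prod_smul_right, toDist.map_smul,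
      dx.map_smul_of_tower, helmholtzInv.map_smul_of_tower]
  have h₅ (u v : Hs s) : ‖F u v‖ ≤ 2 * C * ‖u‖ * ‖v‖ := by
    have h1 := u.norm_toL2_le hs
    have h2 := v.norm_toL2_le hs
    calc ‖F u v‖ ≤ C * (‖u‖ * ‖v.toL2‖ + ‖u.toL2‖ * ‖v‖) := hF' u v
      _ ≤ C * (‖u‖ * ‖v‖ + ‖u‖ * ‖v‖) :=
        mul_le_mul_of_nonneg_left (add_le_add (mul_le_mul_of_nonneg_left h2 (norm_nonneg u))
          (mul_le_mul_of_nonneg_right h1 (norm_nonneg v))) hC0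
      _ = 2 * C * ‖u‖ * ‖v‖ := by ring
  obtain ⟨B, hB⟩ := exists_clm₂ (X := Hs s) (Y := Hs s) (Z := Hs s) F h₁ h₂ h₃ h₄ h₅
  refine ⟨B, C, fun u v ↦ ?_, fun u v ↦ ?_⟩
  · rw [hB, hF]
  · rw [hB]
    exact hF' u v

/-- The bilinear map `(u, v) ↦ (1 - ∂ₓ²/6)⁻¹ ∂ₓ (u v)` on `Hˢ`. -/
def bilinear {s : ℝ} (hs : 0 ≤ s) : Hs s →L[ℝ] Hs s →L[ℝ] Hs s := (exists_bilinear hs).choose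

theorem bilinear_toDist {s : ℝ} (hs : 0 ≤ s) (u v : Hs s) :
    (bilinear hs u v).toDist = helmholtzInv (dx (toDist (prod u.toL2 v.toL2))) :=
  (exists_bilinear hs).choose_spec.choose_spec.1 u v

theorem exists_norm_bilinear_le {s : ℝ} (hs : 0 ≤ s) : ∃ C, 0 ≤ C ∧ ∀ u v : Hs s,
    ‖bilinear hs u v‖ ≤ C * (‖u‖ * ‖v.toL2‖ + ‖u.toL2‖ * ‖v‖) := by
  obtain ⟨C, -, hC⟩ := (exists_bilinear hs).choose_spec
  exact ⟨|C|, abs_nonneg C, fun u v ↦ (hC u v).trans (by gcongr; exact le_abs_self C)⟩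

/-! ### Testing against real Schwartz functions -/

/-- A real Schwartz function as a complex one. -/
def complexify : 𝓢(ℝ, ℝ) →L[ℝ] 𝓢(ℝ, ℂ) := SchwartzMap.postcompCLM Complex.ofRealCLM

@[simp]
theorem complexify_apply (ψ : 𝓢(ℝ, ℝ)) (x : ℝ) : complexify ψ x = (ψ x : ℂ) := rfl

theorem derivCLM_complexify (ψ : 𝓢(ℝ, ℝ)) :
    SchwartzMap.derivCLM ℂ ℂ (complexify ψ) = complexify (SchwartzMap.derivCLM ℝ ℝ ψ) := by
  ext x
  rw [SchwartzMap.derivCLM_apply, complexify_apply, SchwartzMap.derivCLM_apply]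
  exact (ψ.hasDerivAt x).ofReal_comp.deriv

theorem exists_complexify_eq (φ : 𝓢(ℝ, ℂ)) :
    ∃ ψ₁ ψ₂ : 𝓢(ℝ, ℝ), φ = complexify ψ₁ + Complex.I • complexify ψ₂ := by
  refine ⟨SchwartzMap.postcompCLM Complex.reCLM φ, SchwartzMap.postcompCLM Complex.imCLM φ, ?_⟩
  ext x
  simp [mul_comm Complex.I, Complex.re_add_im]

theorem tempered_ext {S T : 𝓢'(ℝ, ℂ)} (h : ∀ ψ : 𝓢(ℝ, ℝ), S (complexify ψ) = T (complexify ψ)) :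
    S = T := by
  ext φ
  obtain ⟨ψ₁, ψ₂, rfl⟩ := exists_complexify_eq φ
  rw [map_add, map_add, map_smul, map_smul, h, h]

theorem toDist_toLp (ψ : 𝓢(ℝ, ℝ)) : toDist (ψ.toLp 2 volume) =
    SchwartzMap.toTemperedDistributionCLM ℝ ℂ volume (complexify ψ) := by
  ext φ
  rw [toDist_apply]
  refine Eq.trans ?_
    (SchwartzMap.toTemperedDistributionCLM_apply_apply volume (complexify ψ) φ).symm
  apply integral_congr_ae
  filter_upwards [ψ.coeFn_toLp 2 volume] with x hx
  rw [hx, complexify_apply, smul_eq_mul]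

theorem dx_toDist_toLp (ψ : 𝓢(ℝ, ℝ)) : dx (toDist (ψ.toLp 2 volume)) =
    toDist ((SchwartzMap.derivCLM ℝ ℝ ψ).toLp 2 volume) := by
  rw [toDist_toLp, toDist_toLp, ← derivCLM_complexify, dx,
    TemperedDistribution.derivCLM_toTemperedDistributionCLM_eq ℂ]

theorem toDist_complexify (f : Lp ℝ 2 (volume : Measure ℝ)) (ψ : 𝓢(ℝ, ℝ)) :
    toDist f (complexify ψ) = ((inner ℝ f (ψ.toLp 2 volume) : ℝ) : ℂ) := by
  rw [toDist_apply, L2.inner_def, ← integral_complex_ofReal]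
  apply integral_congr_ae
  filter_upwards [ψ.coeFn_toLp 2 volume] with x hx
  rw [hx, complexify_apply]
  simp

theorem continuous_toDist {p : ℝ≥0∞} [Fact (1 ≤ p)] :
    Continuous (toDist : Lp ℝ p (volume : Measure ℝ) → 𝓢'(ℝ, ℂ)) :=
  (Lp.toTemperedDistributionCLM ℂ volume p).continuous.comp (toComplex p).continuous

/-! ### The energy space and the resolvent -/

/-- The graph of `w ↦ w_x / √6`: the space `H¹(ℝ)` with the norm `‖w‖² + ‖w_x‖² / 6`. -/
def energySubmodule :
    Submodule ℝ (WithLp 2 (Lp ℝ 2 (volume : Measure ℝ) × Lp ℝ 2 (volume : Measure ℝ))) :=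
  LinearMap.ker (dx.toLinearMap.restrictScalars ℝ ∘ₗ toDist ∘ₗ (WithLp.fstL 2 ℝ _ _).toLinearMap -
    √6 • (toDist ∘ₗ (WithLp.sndL 2 ℝ _ _).toLinearMap))

theorem mem_energySubmodule
    {w : WithLp 2 (Lp ℝ 2 (volume : Measure ℝ) × Lp ℝ 2 (volume : Measure ℝ))} :
    w ∈ energySubmodule ↔ dx (toDist w.fst) = √6 • toDist w.snd := by
  rw [energySubmodule, LinearMap.mem_ker, LinearMap.sub_apply, sub_eq_zero]
  rfl

theorem isClosed_energySubmodule : IsClosed (energySubmodule : Set (WithLp 2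
    (Lp ℝ 2 (volume : Measure ℝ) × Lp ℝ 2 (volume : Measure ℝ)))) := by
  have e : (energySubmodule : Set (WithLp 2
    (Lp ℝ 2 (volume : Measure ℝ) × Lp ℝ 2 (volume : Measure ℝ)))) =
      {w | dx (toDist w.fst) = toDist (√6 • w.snd)} := by
    ext w
    rw [SetLike.mem_coe, mem_energySubmodule, mem_ofPred_eq, toDist.map_smul]
  have h : Continuous fun w : WithLp 2
      (Lp ℝ 2 (volume : Measure ℝ) × Lp ℝ 2 (volume : Measure ℝ)) ↦ √6 • w.snd :=
    (WithLp.sndL 2 ℝ (Lp ℝ 2 (volume : Measure ℝ)) (Lp ℝ 2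
      (volume : Measure ℝ))).continuous.const_smul √6
  rw [e]
  exact isClosed_eq (dx.continuous.comp (continuous_toDist.comp (WithLp.fstL 2 ℝ _ _).continuous))
    (continuous_toDist.comp h)

/-- The space `H¹(ℝ)` with the norm `‖w‖² + ‖w_x‖² / 6`. -/
def EnergySpace : Type := energySubmodule

instance : NormedAddCommGroup EnergySpace :=
  inferInstanceAs (NormedAddCommGroup energySubmodule)

instance : InnerProductSpace ℝ EnergySpace :=
  inferInstanceAs (InnerProductSpace ℝ energySubmodule)

instance : CompleteSpace EnergySpace := isClosed_energySubmodule.completeSpace_coe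

namespace EnergySpace

/-- The inclusion `H¹ → L²`. -/
def val : EnergySpace →L[ℝ] Lp ℝ 2 (volume : Measure ℝ) :=
  (WithLp.fstL 2 ℝ _ _ ∘L energySubmodule.subtypeL : energySubmodule →L[ℝ] _)

/-- The map `w ↦ w_x / √6`. -/
def der : EnergySpace →L[ℝ] Lp ℝ 2 (volume : Measure ℝ) :=
  (WithLp.sndL 2 ℝ _ _ ∘L energySubmodule.subtypeL : energySubmodule →L[ℝ] _)

theorem dx_val (w : EnergySpace) : dx (toDist (val w)) = √6 • toDist (der w) :=
  mem_energySubmodule.1 w.2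

theorem inner_eq (v w : EnergySpace) :
    inner ℝ v w = inner ℝ (val v) (val w) + inner ℝ (der v) (der w) := rfl

theorem norm_val_le (w : EnergySpace) : ‖val w‖ ≤ ‖w‖ := by
  refine le_of_sq_le_sq ?_ (norm_nonneg w)
  rw [← real_inner_self_eq_norm_sq, ← real_inner_self_eq_norm_sq, inner_eq]
  exact le_add_of_nonneg_right real_inner_self_nonneg

theorem norm_der_le (w : EnergySpace) : ‖der w‖ ≤ ‖w‖ := by
  refine le_of_sq_le_sq ?_ (norm_nonneg w)
  rw [← real_inner_self_eq_norm_sq, ← real_inner_self_eq_norm_sq, inner_eq]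
  exact le_add_of_nonneg_left real_inner_self_nonneg

theorem val_injective : Function.Injective val := by
  refine (injective_iff_map_eq_zero val).2 fun w hw ↦ ?_
  have h := dx_val w
  rw [hw, map_zero, map_zero, ← toDist.map_smul, ← toDist.map_zero (M := Lp ℝ 2 volume)] at h
  have h' : der w = 0 := (smul_eq_zero_iff_right (by positivity)).1 (toDist_injective h).symm
  rw [← norm_eq_zero, ← sq_eq_zero_iff, ← real_inner_self_eq_norm_sq, inner_eq, hw, h']
  simp

/-- Schwartz functions belong to `H¹`. -/
def ofSchwartz (ψ : 𝓢(ℝ, ℝ)) : EnergySpace :=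
  ⟨WithLp.toLp 2 (ψ.toLp 2 volume, (√6)⁻¹ • (SchwartzMap.derivCLM ℝ ℝ ψ).toLp 2 volume), by
    rw [mem_energySubmodule]
    change dx (toDist (ψ.toLp 2 volume)) = √6 • toDist ((√6)⁻¹ • _)
    rw [dx_toDist_toLp, toDist.map_smul, smul_inv_smul₀ (by positivity)]⟩

@[simp]
theorem val_ofSchwartz (ψ : 𝓢(ℝ, ℝ)) : val (ofSchwartz ψ) = ψ.toLp 2 volume := rfl

@[simp]
theorem der_ofSchwartz (ψ : 𝓢(ℝ, ℝ)) : der (ofSchwartz ψ) =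
    (√6)⁻¹ • (SchwartzMap.derivCLM ℝ ℝ ψ).toLp 2 volume := rfl

/-- Integration by parts: the energy inner product is the quadratic form of `1 - ∂ₓ²/6`. The
normalisation of the derivative by `√6` is chosen for this. -/
theorem helmholtz_complexify (w : EnergySpace) (ψ : 𝓢(ℝ, ℝ)) :
    helmholtz (toDist (val w)) (complexify ψ) = ((inner ℝ w (ofSchwartz ψ) : ℝ) : ℂ) := by
  have h6 : (√6)⁻¹ = 1 / 6 * √6 := by
    rw [inv_eq_one_div, div_eq_iff (by positivity), mul_assoc, Real.mul_self_sqrt (by norm_num)]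
    norm_num
  have h : dx (√6 • toDist (der w)) (complexify ψ) =
      ((-(√6 * inner ℝ (der w) ((SchwartzMap.derivCLM ℝ ℝ ψ).toLp 2 volume)) : ℝ) : ℂ) := by
    rw [← toDist.map_smul, derivCLM_apply_apply, map_neg, derivCLM_complexify, toDist_complexify,
      real_inner_smul_left, Complex.ofReal_neg]
  rw [helmholtz_apply, dx_val, inner_eq, val_ofSchwartz, der_ofSchwartz, real_inner_smul_right]
  change toDist (val w) (complexify ψ) -
    (1 / 6 : ℂ) * dx (√6 • toDist (der w)) (complexify ψ) = _
  rw [h, toDist_complexify, h6]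
  push_cast
  ring

/-- A `w` orthogonal to all Schwartz functions satisfies `(1 - ∂ₓ²/6) w = 0` as a distribution,
hence vanishes. -/
theorem dense_range_ofSchwartz : Dense (Submodule.span ℝ (range ofSchwartz) : Set EnergySpace) := by
  rw [Submodule.dense_iff_topologicalClosure_eq_top,
    Submodule.topologicalClosure_eq_top_iff, Submodule.eq_bot_iff]
  intro w hw
  apply val_injective
  apply toDist_injective (p := 2)
  apply helmholtz_injective
  apply tempered_ext
  intro ψ
  rw [helmholtz_complexify, map_zero, map_zero, map_zero, zero_apply]
  rw [(Submodule.mem_orthogonal' _ w).1 hw _ (Submodule.subset_span (mem_range_self ψ))]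
  simp

theorem denseRange_ofSchwartz : DenseRange ofSchwartz := by
  refine dense_range_ofSchwartz.mono fun w hw ↦ ?_
  induction hw using Submodule.span_induction with
  | mem x h => exact h
  | zero => exact ⟨0, val_injective (map_zero (SchwartzMap.toLpCLM ℝ ℝ 2 volume))⟩
  | add x y _ _ hx hy =>
    obtain ⟨ψ, rfl⟩ := hx
    obtain ⟨χ, rfl⟩ := hy
    exact ⟨ψ + χ, val_injective (map_add (SchwartzMap.toLpCLM ℝ ℝ 2 volume) ψ χ)⟩
  | smul c x _ hx =>
    obtain ⟨ψ, rfl⟩ := hx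
    exact ⟨c • ψ, val_injective (map_smul (SchwartzMap.toLpCLM ℝ ℝ 2 volume) c ψ)⟩

theorem denseRange_val : DenseRange val := by
  refine (SchwartzMap.denseRange_toLpCLM (E := ℝ) (F := ℝ) (p := 2) ENNReal.ofNat_ne_top
    (μ := (volume : Measure ℝ))).mono ?_
  rintro _ ⟨ψ, rfl⟩
  exact ⟨ofSchwartz ψ, rfl⟩

/-- The operator `(1 - ∂ₓ²/6)⁻¹ : L² → H¹`. -/
def resolvent : Lp ℝ 2 (volume : Measure ℝ) →L[ℝ] EnergySpace := val.adjoint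

/-- The operator `(1 - ∂ₓ²/6)⁻¹ ∂ₓ : L² → H¹`. -/
def resolventDx : Lp ℝ 2 (volume : Measure ℝ) →L[ℝ] EnergySpace := -√6 • der.adjoint

theorem inner_resolventDx (w : EnergySpace) (g : Lp ℝ 2 (volume : Measure ℝ)) :
    inner ℝ w (resolventDx g) = -√6 * inner ℝ (der w) g := by
  rw [resolventDx, smul_apply, real_inner_smul_right,
    ContinuousLinearMap.adjoint_inner_right]

/-- The adjoint of the inclusion `H¹ → L²` gives the weak solution in the sense of Riesz: `⟨w, ψ⟩ =
⟨g, ψ⟩_{L²}` for all test functions `ψ`, which is `(1 - ∂ₓ²/6) w = g`. -/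
theorem toDist_resolvent (g : Lp ℝ 2 (volume : Measure ℝ)) :
    toDist (val (resolvent g)) = helmholtzInv (toDist g) := by
  apply helmholtz_injective
  rw [helmholtz_helmholtzInv]
  refine tempered_ext fun ψ ↦ ?_
  rw [helmholtz_complexify, resolvent, ContinuousLinearMap.adjoint_inner_left, toDist_complexify,
    val_ofSchwartz]

theorem toDist_resolventDx (g : Lp ℝ 2 (volume : Measure ℝ)) :
    toDist (val (resolventDx g)) = helmholtzInv (dx (toDist g)) := by
  apply helmholtz_injective
  rw [helmholtz_helmholtzInv]
  refine tempered_ext fun ψ ↦ ?_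
  rw [helmholtz_complexify, real_inner_comm, inner_resolventDx, derivCLM_apply_apply, map_neg,
    derivCLM_complexify, toDist_complexify, der_ofSchwartz, real_inner_smul_left, real_inner_comm,
    neg_mul, mul_inv_cancel_left₀ (by positivity), Complex.ofReal_neg]

end EnergySpace

/-! ### The embedding of `H¹` in `L∞` and the vanishing of the cubic term -/

theorem integral_norm_mul_norm_schwartz_le (f g : 𝓢(ℝ, ℝ)) :
    ∫ x, ‖f x‖ * ‖g x‖ ≤ ‖f.toLp 2 (volume : Measure ℝ)‖ * ‖g.toLp 2 (volume : Measure ℝ)‖ := by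
  have h := integral_norm_mul_norm_le (toComplex 2 (f.toLp 2 volume))
    (toComplex 2 (g.toLp 2 volume))
  rw [norm_toComplex, norm_toComplex] at h
  refine le_of_eq_of_le (integral_congr_ae ?_) h
  filter_upwards [coeFn_toComplex (f.toLp 2 volume), coeFn_toComplex (g.toLp 2 volume),
    f.coeFn_toLp 2 volume, g.coeFn_toLp 2 volume] with x h1 h2 h3 h4
  rw [h1, h2, h3, h4, Complex.norm_real, Complex.norm_real]

/-- Write `ψ(x)²` as the integral of `2ψψ'` over `(-∞, x]` and apply Cauchy–Schwarz. -/
theorem sq_schwartz_le (ψ : 𝓢(ℝ, ℝ)) (x : ℝ) : ψ x ^ 2 ≤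
    2 * (‖ψ.toLp 2 (volume : Measure ℝ)‖ *
      ‖(SchwartzMap.derivCLM ℝ ℝ ψ).toLp 2 (volume : Measure ℝ)‖) := by
  set ψ' := SchwartzMap.derivCLM ℝ ℝ ψ with hψ'
  have hd (y : ℝ) : HasDerivAt (fun y ↦ ψ y ^ 2) (2 * (ψ y * ψ' y)) y := by
    refine ((ψ.hasDerivAt y).fun_pow 2).congr_deriv ?_
    rw [hψ', SchwartzMap.derivCLM_apply]
    push_cast
    ring
  have hi : Integrable (fun y ↦ ψ y * ψ' y) :=
    (SchwartzMap.pairing (ContinuousLinearMap.mul ℝ ℝ) ψ ψ').integrable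
  have hsq : Tendsto (fun y ↦ ψ y ^ 2) atBot (𝓝 0) := by
    have h := (zero_at_infty ψ).mono_left (atBot_le_cocompact (α := ℝ))
    simpa using h.pow 2
  have h := integral_Iic_of_hasDerivAt_of_tendsto' (a := x) (fun y _ ↦ hd y)
    (hi.const_mul 2).integrableOn hsq
  rw [sub_zero] at h
  rw [← h]
  calc ∫ y in Iic x, 2 * (ψ y * ψ' y) ≤ ‖∫ y in Iic x, 2 * (ψ y * ψ' y)‖ := Real.le_norm_self _
    _ ≤ ∫ y in Iic x, ‖2 * (ψ y * ψ' y)‖ := norm_integral_le_integral_norm _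
    _ ≤ ∫ y, ‖2 * (ψ y * ψ' y)‖ := setIntegral_le_integral (hi.const_mul 2).norm
        (Eventually.of_forall fun y ↦ norm_nonneg _)
    _ = 2 * ∫ y, ‖ψ y‖ * ‖ψ' y‖ := by
        rw [← integral_const_mul]
        simp
    _ ≤ _ := by
        gcongr
        exact integral_norm_mul_norm_schwartz_le ψ ψ'

namespace EnergySpace

theorem abs_schwartz_le (ψ : 𝓢(ℝ, ℝ)) (x : ℝ) : ‖ψ x‖ ≤ 3 * ‖ofSchwartz ψ‖ := by
  have h := sq_schwartz_le ψ x
  have h1 := norm_val_le (ofSchwartz ψ)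
  have h2 := norm_der_le (ofSchwartz ψ)
  rw [val_ofSchwartz] at h1
  rw [der_ofSchwartz, norm_smul, norm_inv, Real.norm_of_nonneg (by positivity),
    inv_mul_le_iff₀ (by positivity)] at h2
  have h6 : √6 ≤ 3 := by
    rw [Real.sqrt_le_left (by norm_num)]
    norm_num
  refine abs_le_of_sq_le_sq (h.trans ?_) (by positivity)
  have h3 : ‖(SchwartzMap.derivCLM ℝ ℝ ψ).toLp 2 (volume : Measure ℝ)‖ ≤ 3 * ‖ofSchwartz ψ‖ :=
    h2.trans (by gcongr)
  have h4 := mul_le_mul h1 h3 (norm_nonneg _) (norm_nonneg _)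
  nlinarith [sq_nonneg ‖ofSchwartz ψ‖]

/-- The bound passes from Schwartz functions to `H¹` by density: `L²` convergence gives almost
everywhere convergence along a subsequence. -/
theorem ae_norm_le (w : EnergySpace) : ∀ᵐ x, ‖val w x‖ ≤ 3 * ‖w‖ := by
  obtain ⟨u, hu, hlim⟩ := mem_closure_iff_seq_limit.1 (denseRange_ofSchwartz w)
  choose ψ hψ using hu
  have h1 : Tendsto (fun n ↦ val (u n)) atTop (𝓝 (val w)) := (val.continuous.tendsto w).comp hlim
  obtain ⟨ns, hmono, hns⟩ := (tendstoInMeasure_of_tendsto_Lp h1).exists_seq_tendsto_ae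
  have h2 : ∀ᵐ x, ∀ n, val (u n) x = ψ n x := by
    refine ae_all_iff.2 fun n ↦ ?_
    rw [← hψ n, val_ofSchwartz]
    exact (ψ n).coeFn_toLp 2 volume
  filter_upwards [hns, h2] with x hx hx'
  refine le_of_tendsto_of_tendsto' hx.norm
    ((hlim.comp hmono.tendsto_atTop).norm.const_mul 3) fun n ↦ ?_
  rw [hx', Function.comp_apply, ← hψ]
  exact abs_schwartz_le _ _

theorem memLp_top (w : EnergySpace) : MemLp (val w) ∞ (volume : Measure ℝ) :=
  memLp_top_of_bound (Lp.aestronglyMeasurable _) _ (ae_norm_le w)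

theorem exists_toLinfty : ∃ J : EnergySpace →L[ℝ] Lp ℝ ∞ (volume : Measure ℝ),
    ∀ w, J w =ᵐ[volume] val w := by
  refine ⟨LinearMap.mkContinuous
    { toFun := fun w ↦ (memLp_top w).toLp (val w)
      map_add' := fun v w ↦ ?_
      map_smul' := fun c w ↦ ?_ } 3 fun w ↦ ?_, fun w ↦ (memLp_top w).coeFn_toLp⟩
  · apply Lp.ext
    filter_upwards [(memLp_top (v + w)).coeFn_toLp, (memLp_top v).coeFn_toLp,
      (memLp_top w).coeFn_toLp, Lp.coeFn_add (val v) (val w),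
      Lp.coeFn_add ((memLp_top v).toLp (val v)) ((memLp_top w).toLp (val w))] with x h1 h2 h3 h4 h5
    rw [h1, h5, Pi.add_apply, h2, h3, map_add, h4, Pi.add_apply]
  · apply Lp.ext
    filter_upwards [(memLp_top (c • w)).coeFn_toLp, (memLp_top w).coeFn_toLp,
      Lp.coeFn_smul c (val w), Lp.coeFn_smul c ((memLp_top w).toLp (val w))] with x h1 h2 h3 h4
    rw [h1, RingHom.id_apply, h4, Pi.smul_apply, h2, map_smul, h3, Pi.smul_apply]
  · change ‖(memLp_top w).toLp (val w)‖ ≤ _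
    rw [Lp.norm_toLp]
    refine ENNReal.toReal_le_of_le_ofReal (by positivity) ?_
    rw [eLpNorm_exponent_top]
    exact eLpNormEssSup_le_of_ae_bound (ae_norm_le w)

theorem exists_mul : ∃ P : Lp ℝ 2 (volume : Measure ℝ) →L[ℝ] EnergySpace →L[ℝ]
    Lp ℝ 2 (volume : Measure ℝ), ∀ g w, P g w =ᵐ[volume] fun x ↦ g x * val w x := by
  obtain ⟨J, hJ⟩ := exists_toLinfty
  refine ⟨((ContinuousLinearMap.mul ℝ ℝ).holderL volume 2 ∞ 2).bilinearComp
    (ContinuousLinearMap.id ℝ _) J, fun g w ↦ ?_⟩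
  filter_upwards [(ContinuousLinearMap.mul ℝ ℝ).coeFn_holder (r := 2) g (J w), hJ w] with x h1 h2
  rw [h2] at h1
  exact h1

/-- Multiplication `L² × H¹ → L²`. -/
def mul : Lp ℝ 2 (volume : Measure ℝ) →L[ℝ] EnergySpace →L[ℝ] Lp ℝ 2 (volume : Measure ℝ) :=
  exists_mul.choose

theorem coeFn_mul (g : Lp ℝ 2 (volume : Measure ℝ)) (w : EnergySpace) :
    mul g w =ᵐ[volume] fun x ↦ g x * val w x := exists_mul.choose_spec g w

theorem toDist_mul (g : Lp ℝ 2 (volume : Measure ℝ)) (w : EnergySpace) :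
    toDist (mul g w) = toDist (prod g (val w)) := by
  ext φ
  rw [toDist_apply, toDist_apply]
  apply integral_congr_ae
  filter_upwards [coeFn_mul g w, coeFn_prod g (val w)] with x h1 h2
  rw [h1, h2]

/-- The nonlinearity `w w_x` does not contribute to the energy. -/
theorem inner_der_mul_self (w : EnergySpace) : inner ℝ (der w) (mul (val w) w) = 0 := by
  have hc : Continuous fun w ↦ inner ℝ (der w) (mul (val w) w) :=
    der.continuous.inner ((mul.continuous.comp val.continuous).clm_apply continuous_id)
  refine denseRange_ofSchwartz.induction_on w (isClosed_eq hc continuous_const) fun ψ ↦ ?_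
  set ψ' := SchwartzMap.derivCLM ℝ ℝ ψ with hψ'
  -- For Schwartz functions the integrand `ψ' ψ²` is a third of the derivative of the integrable
  -- function `ψ³`, so its integral is zero.
  have hd (y : ℝ) : HasDerivAt (fun y ↦ ψ y ^ 3) (3 * (ψ' y * (ψ y * ψ y))) y := by
    refine ((ψ.hasDerivAt y).fun_pow 3).congr_deriv ?_
    rw [hψ', SchwartzMap.derivCLM_apply]
    push_cast
    ring
  have hi : Integrable (fun y ↦ ψ' y * (ψ y * ψ y)) :=
    (SchwartzMap.pairing (ContinuousLinearMap.mul ℝ ℝ) ψ'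
      (SchwartzMap.pairing (ContinuousLinearMap.mul ℝ ℝ) ψ ψ)).integrable
  have hi' : Integrable (fun y ↦ ψ y ^ 3) := by
    refine (SchwartzMap.pairing (ContinuousLinearMap.mul ℝ ℝ) ψ
      (SchwartzMap.pairing (ContinuousLinearMap.mul ℝ ℝ) ψ ψ)).integrable.congr
      (Eventually.of_forall fun y ↦ ?_)
    change ψ y * (ψ y * ψ y) = ψ y ^ 3
    ring
  have h := integral_eq_zero_of_hasDerivAt_of_integrable hd (hi.const_mul 3) hi'
  rw [integral_const_mul, mul_eq_zero_iff_left (by norm_num)] at h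
  rw [der_ofSchwartz, real_inner_smul_left, L2.inner_def, ← hψ']
  refine mul_eq_zero_of_right _ (Eq.trans (integral_congr_ae ?_) h)
  filter_upwards [ψ'.coeFn_toLp 2 volume, ψ.coeFn_toLp 2 volume,
    coeFn_mul (val (ofSchwartz ψ)) (ofSchwartz ψ)] with x h1 h2 h3
  rw [h1, h3, val_ofSchwartz, h2]
  simp only [RCLike.inner_apply, conj_trivial]
  ring

end EnergySpace

/-! ### Global existence from growth and energy bounds -/

section ODE

variable {E : Type*} [NormedAddCommGroup E]

/-- Global existence from a linear growth bound along solutions in a ball. -/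
theorem IsLocLip.exists_isSolOn_of_growth [NormedSpace ℝ E] [CompleteSpace E] {f : ℝ → E → E}
    {T : ℝ} (hf : IsLocLip f T) (hT : 0 ≤ T) {x₀ : E} {K ε R : ℝ} (hK : 0 ≤ K) (hε : 0 ≤ ε)
    (hR : gronwallBound ‖x₀‖ K ε T < R)
    (H : ∀ T' ∈ Icc 0 T, ∀ y, IsSolOn f x₀ T' y → (∀ t ∈ Icc 0 T', ‖y t‖ ≤ R) →
      ∀ t ∈ Icc 0 T', ‖f t (y t)‖ ≤ K * ‖y t‖ + ε) :
    ∃ y, IsSolOn f x₀ T y := by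
  have hm := gronwallBound_mono (norm_nonneg x₀) hε hK
  obtain ⟨y, hy, -⟩ := hf.exists_isSolOn hT
    ((gronwallBound_x0 ‖x₀‖ K ε).symm.le.trans (hm hT)) hR fun T' hT' y hy hyR t ht ↦ by
      have h := norm_le_gronwallBound_of_norm_deriv_right_le hy.continuousOn hy.derivRight
        (by rw [hy.initial]) (fun t ht ↦ H T' hT' y hy hyR t (Ico_subset_Icc_self ht)) t ht
      rw [sub_zero] at h
      exact h.trans (hm (ht.2.trans hT'.2))
  exact ⟨y, hy⟩

/-- Global existence from an energy estimate. -/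
theorem IsLocLip.exists_isSolOn_of_energy [InnerProductSpace ℝ E] [CompleteSpace E]
    {f : ℝ → E → E} {T : ℝ} (hf : IsLocLip f T) (hT : 0 ≤ T) (x₀ : E) {K ε : ℝ} (hK : 0 ≤ K)
    (hε : 0 ≤ ε) (H : ∀ t ∈ Icc 0 T, ∀ x, inner ℝ x (f t x) ≤ K * ‖x‖ ^ 2 + ε) :
    ∃ y, IsSolOn f x₀ T y := by
  have hm := gronwallBound_mono (sq_nonneg ‖x₀‖) (mul_nonneg zero_le_two hε)
    (mul_nonneg zero_le_two hK)
  have h0 : ‖x₀‖ ≤ √(gronwallBound (‖x₀‖ ^ 2) (2 * K) (2 * ε) T) :=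
    Real.le_sqrt_of_sq_le ((gronwallBound_x0 _ _ _).symm.le.trans (hm hT))
  obtain ⟨y, hy, -⟩ := hf.exists_isSolOn hT h0 (lt_add_one _) fun T' hT' y hy _ t ht ↦ by
    have h := le_gronwallBound_of_liminf_deriv_right_le (f := fun t ↦ ‖y t‖ ^ 2)
      (f' := fun t ↦ 2 * inner ℝ (y t) (f t (y t))) (K := 2 * K) (ε := 2 * ε)
      (hy.continuousOn.norm.pow 2)
      (fun t ht r hr ↦ ((hy.derivRight t ht).norm_sq).liminf_right_slope_le hr)
      (by rw [hy.initial]) (fun t ht ↦ by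
        have := H t (Icc_subset_Icc_right hT'.2 (Ico_subset_Icc_self ht)) (y t)
        linarith) t ht
    rw [sub_zero] at h
    exact Real.le_sqrt_of_sq_le (h.trans (hm (ht.2.trans hT'.2)))
  exact ⟨y, hy⟩

/-- A vector field that is the image of a quadratic one with values in another space. -/
theorem isLocLip_image_quadratic [NormedSpace ℝ E] {X : Type*} [NormedAddCommGroup X]
    [NormedSpace ℝ X] (A : X →L[ℝ] E) (ι : E →L[ℝ] X) (P : X →L[ℝ] E →L[ℝ] X) (a b c : ℝ)
    {v ζ : ℝ → X} {h : ℝ → E} {T : ℝ} (hv : ContinuousOn v (Icc 0 T))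
    (hζ : ContinuousOn ζ (Icc 0 T)) (hh : ContinuousOn h (Icc 0 T)) :
    IsLocLip (fun t w ↦ h t - A (v t + ι w + a • P (v t) w - b • P (ζ t) w + c • P (ι w) w)) T := by
  have hPv : ContinuousOn (fun t ↦ a • P (v t)) (Icc 0 T) :=
    (P.continuous.comp_continuousOn hv).const_smul a
  have hPζ : ContinuousOn (fun t ↦ b • P (ζ t)) (Icc 0 T) :=
    (P.continuous.comp_continuousOn hζ).const_smul b
  have hL : ContinuousOn (fun t ↦ -(ContinuousLinearMap.compL ℝ E X E A
      (ι + a • P (v t) - b • P (ζ t)))) (Icc 0 T) :=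
    ((ContinuousLinearMap.compL ℝ E X E A).continuous.comp_continuousOn
      ((continuousOn_const.add hPv).sub hPζ)).neg
  have h := isLocLip_quadratic (c := fun t ↦ h t - A (v t))
    (-c • (ContinuousLinearMap.compL ℝ E X E A) ∘L P ∘L ι)
    (hh.sub (A.continuous.comp_continuousOn hv)) hL
  convert h using 3 with t w
  simp only [map_add, map_sub, map_smul, neg_apply, smul_apply, ContinuousLinearMap.comp_apply,
    ContinuousLinearMap.compL_apply, add_apply, sub_apply]
  module

end ODE

/-! ### The evolution equation as an ODE in `Hˢ` -/

/-- The map `f ↦ (1 - ∂ₓ²/6)⁻¹ ∂ₓ f` from functions to distributions. -/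
def flux {p : ℝ≥0∞} [Fact (1 ≤ p)] : Lp ℝ p (volume : Measure ℝ) →ₗ[ℝ] 𝓢'(ℝ, ℂ) :=
  (helmholtzInv ∘L dx).toLinearMap.restrictScalars ℝ ∘ₗ toDist

theorem flux_apply {p : ℝ≥0∞} [Fact (1 ≤ p)] (f : Lp ℝ p (volume : Measure ℝ)) :
    flux f = helmholtzInv (dx (toDist f)) := rfl

theorem flux_mul (g : Lp ℝ 2 (volume : Measure ℝ)) (w : EnergySpace) :
    flux (EnergySpace.mul g w) = flux (prod g (EnergySpace.val w)) := by
  rw [flux_apply, flux_apply, EnergySpace.toDist_mul]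

/-- The vector field of the evolution equation in `Hˢ` with forcing `h`. -/
def field {s : ℝ} (hs : 0 ≤ s) (ζ h : ℝ → Hs s) (t : ℝ) (u : Hs s) : Hs s :=
  h t + (-helmholtzInvDxHs hs + (1 / 2 : ℝ) • bilinear hs (ζ t)) u +
    (-(3 / 4 : ℝ) • bilinear hs) u u

theorem field_apply {s : ℝ} (hs : 0 ≤ s) (ζ h : ℝ → Hs s) (t : ℝ) (u : Hs s) :
    field hs ζ h t u = h t + (-helmholtzInvDxHs hs u + (1 / 2 : ℝ) • bilinear hs (ζ t) u) +
      -(3 / 4 : ℝ) • bilinear hs u u := rfl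

theorem field_toDist {s : ℝ} (hs : 0 ≤ s) (ζ h : ℝ → Hs s) (t : ℝ) (u : Hs s) :
    (field hs ζ h t u).toDist = (h t).toDist + (-flux u.toL2 + (1 / 2 : ℝ) •
      flux (prod (ζ t).toL2 u.toL2)) + -(3 / 4 : ℝ) • flux (prod u.toL2 u.toL2) := by
  rw [field_apply, Hs.toDist.map_add, Hs.toDist.map_add, Hs.toDist.map_add, Hs.toDist.map_neg,
    Hs.toDist.map_smul, Hs.toDist.map_smul, helmholtzInvDxHs_toDist, bilinear_toDist,
    bilinear_toDist]
  rfl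

theorem isLocLip_field {s : ℝ} (hs : 0 ≤ s) {ζ h : ℝ → Hs s} {T : ℝ}
    (hζ : ContinuousOn ζ (Icc 0 T)) (hh : ContinuousOn h (Icc 0 T)) :
    IsLocLip (field hs ζ h) T := by
  have hB : ContinuousOn (fun t ↦ (1 / 2 : ℝ) • bilinear hs (ζ t)) (Icc 0 T) :=
    ((bilinear hs).continuous.comp_continuousOn hζ).const_smul (1 / 2 : ℝ)
  exact isLocLip_quadratic (-(3 / 4 : ℝ) • bilinear hs) hh (continuousOn_const.add hB)

/-! ### Existence in `L²` by splitting the data -/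

/-- The part of the equation that carries the initial value in `L²`. -/
theorem exists_small_solution {ζ : ℝ → Hs 0} {T : ℝ} (hT : 0 ≤ T) (hζ : ContinuousOn ζ (Icc 0 T)) :
    ∃ δ > 0, ∀ v₀ : Hs 0, ‖v₀‖ < δ → ∃ v : ℝ → Hs 0, IsSolOn (fun t v ↦
      (1 / 2 : ℝ) • bilinear le_rfl (ζ t) v + -(3 / 4 : ℝ) • bilinear le_rfl v v) v₀ T v := by
  have := completeSpace_Hs (le_refl (0 : ℝ))
  set B := bilinear (le_refl (0 : ℝ)) with hB
  obtain ⟨M, hM⟩ := isCompact_Icc.exists_bound_of_continuousOn hζ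
  have hM0 : 0 ≤ M := (norm_nonneg _).trans (hM 0 ⟨le_rfl, hT⟩)
  have hloc : IsLocLip (fun t v ↦ (1 / 2 : ℝ) • B (ζ t) v + -(3 / 4 : ℝ) • B v v) T := by
    have hBζ : ContinuousOn (fun t ↦ (1 / 2 : ℝ) • B (ζ t)) (Icc 0 T) :=
      (B.continuous.comp_continuousOn hζ).const_smul (1 / 2 : ℝ)
    have h := isLocLip_quadratic (c := fun _ ↦ 0) (-(3 / 4 : ℝ) • B) continuousOn_const hBζ
    simp only [zero_add] at h
    exact h
  set K := ‖B‖ * (M + 1) with hK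
  have hK0 : 0 ≤ K := by positivity
  -- While `‖v‖ ≤ 1` the field is at most `K‖v‖`, so Gronwall gives `‖v‖ ≤ ‖v₀‖ exp(KT)`. This `δ`
  -- keeps that below 1 up to time `T`.
  refine ⟨Real.exp (-(K * T)), Real.exp_pos _, fun v₀ hv₀ ↦ ?_⟩
  refine hloc.exists_isSolOn_of_growth hT hK0 le_rfl (R := 1) ?_ ?_
  · rw [gronwallBound_ε0]
    calc ‖v₀‖ * Real.exp (K * T) < Real.exp (-(K * T)) * Real.exp (K * T) := by gcongr
      _ = 1 := by rw [← Real.exp_add, neg_add_cancel, Real.exp_zero]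
  · intro T' hT' y hy hyR t ht
    rw [add_zero]
    have h1 : ‖B (ζ t) (y t)‖ ≤ ‖B‖ * M * ‖y t‖ :=
      (B.le_opNorm₂ _ _).trans (by gcongr; exact hM t (Icc_subset_Icc_right hT'.2 ht))
    have h2 : ‖B (y t) (y t)‖ ≤ ‖B‖ * 1 * ‖y t‖ :=
      (B.le_opNorm₂ _ _).trans (by gcongr; exact hyR t ht)
    refine (norm_add_le _ _).trans ?_
    rw [norm_smul, norm_smul, norm_neg, Real.norm_of_nonneg (by norm_num),
      Real.norm_of_nonneg (by norm_num)]
    have h3 : 0 ≤ ‖B‖ * M * ‖y t‖ := by positivity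
    have h4 : 0 ≤ ‖B‖ * 1 * ‖y t‖ := by positivity
    rw [hK]
    linarith

open EnergySpace in
-- After the cubic term drops out, what remains in the flux is affine in `w` with `L²` coefficients,
-- because multiplication maps `L² × H¹` to `L²`. Pairing with `w` is then at most quadratic.
theorem energy_estimate {v ζ : Lp ℝ 2 (volume : Measure ℝ)} {h : EnergySpace} {M : ℝ}
    (h1 : ‖v‖ ≤ M) (h2 : ‖ζ‖ ≤ M) (h3 : ‖h‖ ≤ M) (w : EnergySpace) :
    inner ℝ w (h - resolventDx (v + val w + (3 / 2 : ℝ) • mul v w - (1 / 2 : ℝ) • mul ζ w +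
      (3 / 4 : ℝ) • mul (val w) w)) ≤
      (1 + 3 * (1 + 2 * (‖EnergySpace.mul‖ * M))) * ‖w‖ ^ 2 + 4 * M ^ 2 := by
  set q := v + val w + (3 / 2 : ℝ) • mul v w - (1 / 2 : ℝ) • mul ζ w with hq
  have hM0 : 0 ≤ M := (norm_nonneg _).trans h1
  have e : inner ℝ w (h - resolventDx (q + (3 / 4 : ℝ) • mul (val w) w)) =
      inner ℝ w h + √6 * inner ℝ (der w) q := by
    rw [inner_sub_right, inner_resolventDx, inner_add_right (der w), real_inner_smul_right,
      inner_der_mul_self]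
    ring
  have h6 : √6 ≤ 3 := by
    rw [Real.sqrt_le_left (by norm_num)]
    norm_num
  have h4 : ‖mul v w‖ ≤ ‖EnergySpace.mul‖ * M * ‖w‖ :=
    (EnergySpace.mul.le_opNorm₂ _ _).trans (by gcongr)
  have h5 : ‖mul ζ w‖ ≤ ‖EnergySpace.mul‖ * M * ‖w‖ :=
    (EnergySpace.mul.le_opNorm₂ _ _).trans (by gcongr)
  have h7 : ‖q‖ ≤ M + (1 + 2 * (‖EnergySpace.mul‖ * M)) * ‖w‖ := by
    refine (norm_sub_le _ _).trans ((add_le_add_left norm_add₃_le _).trans ?_)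
    rw [norm_smul, norm_smul, Real.norm_of_nonneg (by norm_num), Real.norm_of_nonneg (by norm_num)]
    linarith [norm_val_le w]
  have h8 : inner ℝ (der w) q ≤ ‖w‖ * (M + (1 + 2 * (‖EnergySpace.mul‖ * M)) * ‖w‖) :=
    (real_inner_le_norm _ _).trans (mul_le_mul (norm_der_le w) h7 (norm_nonneg _) (norm_nonneg _))
  have h9 : √6 * inner ℝ (der w) q ≤
      3 * (‖w‖ * (M + (1 + 2 * (‖EnergySpace.mul‖ * M)) * ‖w‖)) :=
    (mul_le_mul_of_nonneg_left h8 (by positivity)).trans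
      (mul_le_mul_of_nonneg_right h6 (by positivity))
  have h10 : inner ℝ w h ≤ ‖w‖ * M := (real_inner_le_norm _ _).trans (by gcongr)
  rw [e]
  -- The forcing contributes `M‖w‖` and the flux `3M‖w‖`; the square bounds their sum by `‖w‖² +
  -- 4M²`.
  nlinarith [sq_nonneg (‖w‖ - 2 * M)]

open EnergySpace in
/-- The part of the equation that lives in `H¹`. -/
theorem exists_energy_solution {v ζ : ℝ → Lp ℝ 2 (volume : Measure ℝ)} {h : ℝ → EnergySpace}
    {T : ℝ} (hT : 0 ≤ T) (hv : ContinuousOn v (Icc 0 T)) (hζ : ContinuousOn ζ (Icc 0 T))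
    (hh : ContinuousOn h (Icc 0 T)) (w₀ : EnergySpace) :
    ∃ w : ℝ → EnergySpace, IsSolOn (fun t w ↦ h t - resolventDx (v t + val w +
      (3 / 2 : ℝ) • mul (v t) w - (1 / 2 : ℝ) • mul (ζ t) w + (3 / 4 : ℝ) • mul (val w) w))
      w₀ T w := by
  obtain ⟨M₁, hM₁⟩ := isCompact_Icc.exists_bound_of_continuousOn hv
  obtain ⟨M₂, hM₂⟩ := isCompact_Icc.exists_bound_of_continuousOn hζ
  obtain ⟨M₃, hM₃⟩ := isCompact_Icc.exists_bound_of_continuousOn hh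
  have hM0 : 0 ≤ max M₁ (max M₂ M₃) :=
    (norm_nonneg _).trans ((hM₁ 0 ⟨le_rfl, hT⟩).trans (le_max_left _ _))
  exact (isLocLip_image_quadratic resolventDx val EnergySpace.mul _ _ _ hv hζ
    hh).exists_isSolOn_of_energy hT w₀ (by positivity) (by positivity) fun t ht w ↦
      energy_estimate ((hM₁ t ht).trans (le_max_left _ _))
        ((hM₂ t ht).trans ((le_max_left _ _).trans (le_max_right _ _)))
        ((hM₃ t ht).trans ((le_max_right _ _).trans (le_max_right _ _))) w

open EnergySpace in
/-- Existence on `[0, T]` in `L²`. -/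
theorem exists_isSolOn_zero {ζ h : ℝ → Hs 0} {k : ℝ → EnergySpace} {T : ℝ} (hT : 0 ≤ T)
    (hζ : ContinuousOn ζ (Icc 0 T)) (hk : ContinuousOn k (Icc 0 T))
    (hkh : ∀ t ∈ Icc 0 T, (h t).toL2 = val (k t)) (u₀ : Hs 0) :
    ∃ u, IsSolOn (field le_rfl ζ h) u₀ T u := by
  obtain ⟨δ, hδ, hsmall⟩ := exists_small_solution hT hζ
  -- `δ` depends only on `T` and `ζ`, so density of `H¹` in `L²` supplies the splitting.
  obtain ⟨w₀, hw₀⟩ := denseRange_val.exists_dist_lt u₀.toL2 hδ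
  obtain ⟨v, hv⟩ := hsmall (u₀ - ofL2 (val w₀)) (by
    rw [norm_Hs_zero, Hs.toL2.map_sub, ofL2_toL2, ← dist_eq_norm]
    exact hw₀)
  have hvc : ContinuousOn (fun t ↦ (v t).toL2) (Icc 0 T) :=
    (Hs.toL2L le_rfl).continuous.comp_continuousOn hv.continuousOn
  have hζc : ContinuousOn (fun t ↦ (ζ t).toL2) (Icc 0 T) :=
    (Hs.toL2L le_rfl).continuous.comp_continuousOn hζ
  obtain ⟨w, hw⟩ := exists_energy_solution hT hvc hζc hk w₀
  refine ⟨fun t ↦ v t + ofL2 (val (w t)), ?_, fun t ht ↦ ?_⟩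
  · rw [hv.initial, hw.initial, sub_add_cancel]
  · have hd := (hv.deriv t ht).add
      ((ofL2 ∘L val).hasFDerivAt.comp_hasDerivWithinAt t (hw.deriv t ht))
    -- The two equations add up to the full one: the coefficient `3/2` of `vw` in the equation for
    -- `w` is the cross term of `¾(v + w)²`.
    refine hd.congr_deriv (Hs.toDist_injective ?_)
    have hr (g : Lp ℝ 2 (volume : Measure ℝ)) : toDist (val (resolventDx g)) = flux g :=
      toDist_resolventDx g
    have hb (a b : Hs 0) : (bilinear le_rfl a b).toDist = flux (prod a.toL2 b.toL2) :=
      bilinear_toDist le_rfl a b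
    have hk' : (h t).toDist = toDist (val (k t)) := congrArg toDist (hkh t ht)
    rw [field_toDist, hk', ContinuousLinearMap.comp_apply, Hs.toDist.map_add, Hs.toDist.map_add,
      Hs.toDist.map_smul, Hs.toDist.map_smul, hb, hb, ofL2_toDist, val.map_sub, toDist.map_sub, hr,
      Hs.toL2.map_add, ofL2_toL2, prod_add_right, prod_add_left, prod_add_right, prod_add_right,
      prod_comm (val (w t)) (v t).toL2]
    simp only [flux.map_add, flux.map_sub, flux.map_smul, flux_mul]
    module

/-! ### Persistence of regularity -/

theorem field_inclusion {s : ℝ} (hs : 0 ≤ s) (ζ h : ℝ → Hs s) (t : ℝ) (u : Hs s) :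
    inclusion le_rfl hs (field hs ζ h t u) =
      field le_rfl (fun t ↦ inclusion le_rfl hs (ζ t)) (fun t ↦ inclusion le_rfl hs (h t)) t
        (inclusion le_rfl hs u) := by
  apply Hs.toDist_injective
  rw [inclusion_toDist, field_toDist, field_toDist, inclusion_toDist, inclusion_toL2,
    inclusion_toL2]

/-- Tame estimate for the vector field. -/
theorem exists_norm_field_le {s : ℝ} (hs : 0 ≤ s) : ∃ C, 0 ≤ C ∧ ∀ (ζ h : ℝ → Hs s) (t : ℝ)
    (u : Hs s), ‖field hs ζ h t u‖ ≤ C * (1 + ‖ζ t‖ + ‖u.toL2‖) * ‖u‖ + ‖h t‖ := by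
  obtain ⟨C, hC0, hC⟩ := exists_norm_bilinear_le hs
  refine ⟨max ‖helmholtzInvDxHs hs‖ (2 * C), le_max_of_le_left (norm_nonneg _),
    fun ζ h t u ↦ ?_⟩
  set D := max ‖helmholtzInvDxHs hs‖ (2 * C)
  have hD0 : 0 ≤ D := le_max_of_le_left (norm_nonneg _)
  have h1 : ‖helmholtzInvDxHs hs u‖ ≤ D * ‖u‖ :=
    (helmholtzInvDxHs hs).le_of_opNorm_le (le_max_left _ _) u
  have h2 : ‖bilinear hs (ζ t) u‖ ≤ D * (‖ζ t‖ * ‖u‖) := by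
    refine (hC _ _).trans ?_
    have e : 2 * C * (‖ζ t‖ * ‖u‖) ≤ D * (‖ζ t‖ * ‖u‖) := by
      gcongr
      exact le_max_right _ _
    refine le_trans ?_ e
    have h3 : C * (‖ζ t‖ * ‖u.toL2‖) ≤ C * (‖ζ t‖ * ‖u‖) := by
      gcongr
      exact u.norm_toL2_le hs
    have h4 : C * (‖(ζ t).toL2‖ * ‖u‖) ≤ C * (‖ζ t‖ * ‖u‖) := by
      gcongr
      exact (ζ t).norm_toL2_le hs
    linarith
  have h3 : ‖bilinear hs u u‖ ≤ D * (‖u.toL2‖ * ‖u‖) := by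
    refine (hC _ _).trans ?_
    have e : 2 * C * (‖u.toL2‖ * ‖u‖) ≤ D * (‖u.toL2‖ * ‖u‖) := by
      gcongr
      exact le_max_right _ _
    linarith
  have h4 : 0 ≤ D * (‖ζ t‖ * ‖u‖) := by positivity
  have h5 : 0 ≤ D * (‖u.toL2‖ * ‖u‖) := by positivity
  rw [field_apply]
  refine norm_add₃_le.trans ?_
  have h6 := norm_add_le (-helmholtzInvDxHs hs u) ((1 / 2 : ℝ) • bilinear hs (ζ t) u)
  rw [norm_neg, norm_smul, Real.norm_of_nonneg (by norm_num)] at h6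
  rw [norm_smul (-(3 / 4 : ℝ)), norm_neg, Real.norm_of_nonneg (by norm_num)]
  linarith

open EnergySpace in
/-- Existence on `[0, T]` in `Hˢ`. -/
theorem exists_isSolOn {s : ℝ} (hs : 0 ≤ s) {ζ h : ℝ → Hs s} {k : ℝ → EnergySpace} {T : ℝ}
    (hT : 0 ≤ T) (hζ : ContinuousOn ζ (Icc 0 T)) (hh : ContinuousOn h (Icc 0 T))
    (hk : ContinuousOn k (Icc 0 T)) (hkh : ∀ t ∈ Icc 0 T, (h t).toL2 = val (k t)) (u₀ : Hs s) :
    ∃ u, IsSolOn (field hs ζ h) u₀ T u := by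
  have := completeSpace_Hs hs
  set ι := inclusion le_rfl hs with hι
  have hζ' : ContinuousOn (fun t ↦ ι (ζ t)) (Icc 0 T) := ι.continuous.comp_continuousOn hζ
  have hh' : ContinuousOn (fun t ↦ ι (h t)) (Icc 0 T) := ι.continuous.comp_continuousOn hh
  obtain ⟨u, hu⟩ := exists_isSolOn_zero (h := fun t ↦ ι (h t)) hT hζ' hk
    (fun t ht ↦ (inclusion_toL2 le_rfl hs (h t)).trans (hkh t ht)) (ι u₀)
  obtain ⟨M₀, hM₀⟩ := hu.exists_norm_le
  obtain ⟨M₁, hM₁⟩ := isCompact_Icc.exists_bound_of_continuousOn hζ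
  obtain ⟨M₂, hM₂⟩ := isCompact_Icc.exists_bound_of_continuousOn hh
  have hM₀' : 0 ≤ M₀ := (norm_nonneg _).trans (hM₀ 0 ⟨le_rfl, hT⟩)
  have hM₁' : 0 ≤ M₁ := (norm_nonneg _).trans (hM₁ 0 ⟨le_rfl, hT⟩)
  have hM₂' : 0 ≤ M₂ := (norm_nonneg _).trans (hM₂ 0 ⟨le_rfl, hT⟩)
  obtain ⟨C, hC0, hC⟩ := exists_norm_field_le hs
  refine (isLocLip_field hs hζ hh).exists_isSolOn_of_growth hT (K := C * (1 + M₁ + M₀)) (ε := M₂)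
    (by positivity) hM₂' (lt_add_one _) fun T' hT' y hy _ t ht ↦ ?_
  have hιy : IsSolOn (field le_rfl (fun t ↦ ι (ζ t)) (fun t ↦ ι (h t))) (ι u₀) T'
      (fun t ↦ ι (y t)) := by
    refine ⟨congrArg ι hy.initial, fun t ht ↦ ?_⟩
    refine (ι.hasFDerivAt.comp_hasDerivWithinAt t (hy.deriv t ht)).congr_deriv ?_
    exact field_inclusion hs ζ h t (y t)
  -- Uniqueness in `L²` identifies the `Hˢ` solution with `u`, whose bound `M₀` does not depend on
  -- `T'`. With it the tame estimate becomes linear in `‖y t‖`.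
  have heq := hιy.eqOn ((isLocLip_field le_rfl hζ' hh').mono hT'.2) (hu.mono hT'.2) ht
  have ht' : t ∈ Icc 0 T := Icc_subset_Icc_right hT'.2 ht
  have hy0 : ‖(y t).toL2‖ ≤ M₀ := by
    have h1 := hM₀ t ht'
    rwa [← heq, norm_Hs_zero, inclusion_toL2] at h1
  refine (hC ζ h t (y t)).trans ?_
  gcongr
  · exact hM₁ t ht'
  · exact hM₂ t ht'

/-! ### Weak solutions and conclusion -/

theorem ofReal_smul_dist (c : ℝ) (T : 𝓢'(ℝ, ℂ)) : (c : ℂ) • T = c • T := rfl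

/-- The action of the elements of `Hˢ` on a Schwartz function. -/
def pairing {s : ℝ} (hs : 0 ≤ s) (φ : 𝓢(ℝ, ℂ)) : Hs s →L[ℝ] ℂ where
  toFun u := u.toDist φ
  map_add' u v := by rw [map_add]; rfl
  map_smul' c u := by rw [map_smul]; rfl
  cont := (PointwiseConvergenceCLM.evalCLM (RingHom.id ℂ) ℂ φ).continuous.comp
    (continuous_toDist.comp (Hs.toL2L hs).continuous)

/-- The forcing term `-¼ (1 - ∂ₓ²/6)⁻¹ ∂ₓ z₂ + ½ (1 - ∂ₓ²/6)⁻¹ z₁`. -/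
def forcing {s : ℝ} (hs : 0 ≤ s) : Hs s × Hs s →L[ℝ] Hs s :=
  (-(1 / 4 : ℝ) • helmholtzInvDxHs hs).comp (ContinuousLinearMap.snd ℝ _ _) +
    ((1 / 2 : ℝ) • helmholtzInvHs hs).comp (ContinuousLinearMap.fst ℝ _ _)

theorem forcing_toDist {s : ℝ} (hs : 0 ≤ s) (z₁ z₂ : Hs s) : (forcing hs (z₁, z₂)).toDist =
    helmholtzInv (-(1 / 4 : ℂ) • dx z₂.toDist + (1 / 2 : ℂ) • z₁.toDist) := by
  have e : forcing hs (z₁, z₂) =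
      -(1 / 4 : ℝ) • helmholtzInvDxHs hs z₂ + (1 / 2 : ℝ) • helmholtzInvHs hs z₁ := rfl
  rw [e, Hs.toDist.map_add, Hs.toDist.map_smul, Hs.toDist.map_smul, helmholtzInvDxHs_toDist,
    helmholtzInvHs_toDist, helmholtzInv.map_add, helmholtzInv.map_smul, helmholtzInv.map_smul,
    ← ofReal_smul_dist, ← ofReal_smul_dist]
  push_cast
  rfl

/-- The forcing term as an element of `H¹`. -/
theorem forcing_toL2 {s : ℝ} (hs : 0 ≤ s) (z₁ z₂ : Hs s) : (forcing hs (z₁, z₂)).toL2 =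
    EnergySpace.val (-(1 / 4 : ℝ) • EnergySpace.resolventDx z₂.toL2 +
      (1 / 2 : ℝ) • EnergySpace.resolvent z₁.toL2) := by
  apply toDist_injective
  have e : forcing hs (z₁, z₂) =
      -(1 / 4 : ℝ) • helmholtzInvDxHs hs z₂ + (1 / 2 : ℝ) • helmholtzInvHs hs z₁ := rfl
  change (forcing hs (z₁, z₂)).toDist = _
  rw [e, Hs.toDist.map_add, Hs.toDist.map_smul, Hs.toDist.map_smul, helmholtzInvDxHs_toDist,
    helmholtzInvHs_toDist, EnergySpace.val.map_add, EnergySpace.val.map_smul,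
    EnergySpace.val.map_smul, toDist.map_add, toDist.map_smul, toDist.map_smul,
    EnergySpace.toDist_resolvent, EnergySpace.toDist_resolventDx]
  rfl

/-- The equation determines the time derivative. -/
theorem equation_iff {s : ℝ} (hs : 0 ≤ s) (ζ : ℝ → Hs s) (z₁ z₂ u : Hs s) (t : ℝ)
    (D : 𝓢'(ℝ, ℂ)) :
    D + dx (u.toDist + (3 / 4 : ℂ) • toDist (prod u.toL2 u.toL2)
        - (1 / 2 : ℂ) • toDist (prod (ζ t).toL2 u.toL2)) - (1 / 6 : ℂ) • dx (dx D)
      = -(1 / 4 : ℂ) • dx z₂.toDist + (1 / 2 : ℂ) • z₁.toDist ↔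
    D = (field hs ζ (fun _ ↦ forcing hs (z₁, z₂)) t u).toDist := by
  have e : helmholtz (field hs ζ (fun _ ↦ forcing hs (z₁, z₂)) t u).toDist =
      -(1 / 4 : ℂ) • dx z₂.toDist + (1 / 2 : ℂ) • z₁.toDist -
      dx (u.toDist + (3 / 4 : ℂ) • toDist (prod u.toL2 u.toL2)
        - (1 / 2 : ℂ) • toDist (prod (ζ t).toL2 u.toL2)) := by
    rw [field_toDist, forcing_toDist, flux_apply, flux_apply, flux_apply, ← ofReal_smul_dist,
      ← ofReal_smul_dist, helmholtz.map_add, helmholtz.map_add, helmholtz.map_add,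
      helmholtz.map_neg, helmholtz.map_smul, helmholtz.map_smul, helmholtz_helmholtzInv,
      helmholtz_helmholtzInv, helmholtz_helmholtzInv, helmholtz_helmholtzInv, dx.map_sub,
      dx.map_add, dx.map_smul, dx.map_smul]
    change _ + (-dx u.toDist + _) + _ = _
    push_cast
    module
  rw [← helmholtz_injective.eq_iff (a := D), e, helmholtz_apply, eq_sub_iff_add_eq,
    add_sub_right_comm]

theorem hasDerivWithinAt_toDist_apply {s : ℝ} (hs : 0 ≤ s) {u : ℝ → Hs s} {u' : Hs s} {S : Set ℝ}
    {t : ℝ} (h : HasDerivWithinAt u u' S t) (φ : 𝓢(ℝ, ℂ)) :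
    HasDerivWithinAt (fun τ ↦ (u τ).toDist φ) (u'.toDist φ) S t :=
  (BBM.pairing hs φ).hasFDerivAt.comp_hasDerivWithinAt t h

/-- A curve whose weak time derivative is a continuous curve in `Hˢ` is differentiable. -/
theorem hasDerivWithinAt_of_hasTimeDeriv {s : ℝ} (hs : 0 ≤ s) {u g : ℝ → Hs s}
    (hg : ContinuousOn g (Ici 0))
    (h : HasTimeDeriv (fun t ↦ (u t).toDist) (fun t ↦ (g t).toDist)) :
    ∀ t ∈ Ici (0 : ℝ), HasDerivWithinAt u (g t) (Ici 0) t := by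
  have := completeSpace_Hs hs
  have hG : Continuous fun t ↦ g (max 0 t) :=
    hg.comp_continuous (by fun_prop) fun t ↦ le_max_left 0 t
  -- The curve is compared with the primitive of `g`: tested against any `φ`, the difference has
  -- zero derivative. Extending `g` by `g 0` to negative times makes the two-sided fundamental
  -- theorem applicable at `0`.
  set y : ℝ → Hs s := fun t ↦ u 0 + ∫ τ in (0 : ℝ)..t, g (max 0 τ) with hy
  have hy' (t : ℝ) (ht : t ∈ Ici (0 : ℝ)) : HasDerivWithinAt y (g t) (Ici 0) t := by
    have h1 := ((hG.integral_hasStrictDerivAt 0 t).hasDerivAt.const_add (u 0)).hasDerivWithinAt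
      (s := Ici 0)
    rwa [max_eq_right ht] at h1
  have heq : EqOn u y (Ici 0) := by
    intro t ht
    apply Hs.toDist_injective
    ext φ
    have hd (τ : ℝ) (hτ : τ ∈ Ici (0 : ℝ)) :
        HasDerivWithinAt (fun τ ↦ (u τ).toDist φ - (y τ).toDist φ) 0 (Ici 0) τ :=
      ((h τ hτ φ).sub (hasDerivWithinAt_toDist_apply hs (hy' τ hτ) φ)).congr_deriv (sub_self _)
    have h0 := constant_of_has_deriv_right_zero (a := 0) (b := t)
      (fun τ hτ ↦ (hd τ hτ.1).continuousWithinAt.mono Icc_subset_Ici_self)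
      (fun τ hτ ↦ (hd τ hτ.1).mono (Ici_subset_Ici.2 hτ.1)) t ⟨ht, le_rfl⟩
    have hy0 : y 0 = u 0 := by simp [hy]
    rw [hy0, sub_self] at h0
    exact sub_eq_zero.1 h0
  intro t ht
  exact (hy' t ht).congr heq (heq ht)

/-- Weak solutions are the solutions of the evolution equation in `Hˢ`. -/
theorem isSolution_iff {s : ℝ} (hs : 0 ≤ s) {ζ h : ℝ → Hs s} (hζ : ContinuousOn ζ (Ici 0))
    (hh : ContinuousOn h (Ici 0))
    (hh' : ∀ t, h t = forcing hs (derivWithin ζ (Ici 0) t, iteratedDerivWithin 2 ζ (Ici 0) t))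
    (η₀ : Hs s) (η : ℝ → Hs s) : IsSolution ζ η₀ η ↔
      η 0 = η₀ ∧ ∀ t ∈ Ici (0 : ℝ), HasDerivWithinAt η (field hs ζ h t (η t)) (Ici 0) t := by
  have hf (t : ℝ) (u : Hs s) : field hs ζ h t u = field hs ζ (fun _ ↦ forcing hs
      (derivWithin ζ (Ici 0) t, iteratedDerivWithin 2 ζ (Ici 0) t)) t u := by
    rw [field_apply, field_apply, hh']
  constructor
  · rintro ⟨hc, h0, D, hD, heq⟩
    refine ⟨h0, hasDerivWithinAt_of_hasTimeDeriv hs ?_ fun t ht φ ↦ ?_⟩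
    · exact (hh.add ((continuousOn_const.add
        (((bilinear hs).continuous.comp_continuousOn hζ).const_smul (1 / 2 : ℝ))).clm_apply hc)).add
        ((((-(3 / 4 : ℝ) • bilinear hs)).continuous.comp_continuousOn hc).clm_apply hc)
    · have h1 := (equation_iff hs ζ _ _ _ t _).1 (heq t ht)
      rw [← hf] at h1
      have h2 := hD t ht φ
      rw [h1] at h2
      exact h2
  · rintro ⟨h0, hd⟩
    refine ⟨fun t ht ↦ (hd t ht).continuousWithinAt, h0, fun t ↦ (field hs ζ h t (η t)).toDist,
      fun t ht φ ↦ hasDerivWithinAt_toDist_apply hs (hd t ht) φ, fun t _ ↦ ?_⟩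
    exact (equation_iff hs ζ _ _ _ t _).2 (congrArg Hs.toDist (hf t (η t)))

theorem isSolOn_of_hasDerivWithinAt {E : Type*} [NormedAddCommGroup E] [NormedSpace ℝ E]
    {f : ℝ → E → E} {x₀ : E} {y : ℝ → E} (h0 : y 0 = x₀)
    (h : ∀ t ∈ Ici (0 : ℝ), HasDerivWithinAt y (f t (y t)) (Ici 0) t) (T : ℝ) :
    IsSolOn f x₀ T y :=
  ⟨h0, fun t ht ↦ (h t ht.1).mono Icc_subset_Ici_self⟩

theorem exists_unique_isSolution {s : ℝ} (hs : 0 ≤ s) {ζ : ℝ → Hs s}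
    (hζ : ContDiffOn ℝ 2 ζ (Ici 0)) (η₀ : Hs s) : ∃ η : ℝ → Hs s, IsSolution ζ η₀ η ∧
      ∀ η' : ℝ → Hs s, IsSolution ζ η₀ η' → EqOn η' η (Ici 0) := by
  have h1 : ContinuousOn (derivWithin ζ (Ici 0)) (Ici 0) :=
    hζ.continuousOn_derivWithin (uniqueDiffOn_Ici 0) one_le_two
  have h2 : ContinuousOn (iteratedDerivWithin 2 ζ (Ici 0)) (Ici 0) :=
    hζ.continuousOn_iteratedDerivWithin le_rfl (uniqueDiffOn_Ici 0)
  set h : ℝ → Hs s := fun t ↦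
    forcing hs (derivWithin ζ (Ici 0) t, iteratedDerivWithin 2 ζ (Ici 0) t) with hh
  have hc : ContinuousOn h (Ici 0) := (forcing hs).continuous.comp_continuousOn (h1.prodMk h2)
  -- The forcing is a continuous curve in `H¹` even when `ζ_t` and `ζ_tt` are only in `L²`, since
  -- both resolvents map `L²` to `H¹`. The energy argument needs this.
  have hk : ContinuousOn (fun t ↦
      -(1 / 4 : ℝ) • EnergySpace.resolventDx (iteratedDerivWithin 2 ζ (Ici 0) t).toL2 +
      (1 / 2 : ℝ) • EnergySpace.resolvent (derivWithin ζ (Ici 0) t).toL2) (Ici 0) :=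
    ((EnergySpace.resolventDx.continuous.comp_continuousOn
      ((Hs.toL2L hs).continuous.comp_continuousOn h2)).const_smul (-(1 / 4 : ℝ))).add
    ((EnergySpace.resolvent.continuous.comp_continuousOn
      ((Hs.toL2L hs).continuous.comp_continuousOn h1)).const_smul (1 / 2 : ℝ))
  have hI (T : ℝ) : Icc 0 T ⊆ Ici 0 := Icc_subset_Ici_self
  have hloc (T : ℝ) : IsLocLip (field hs ζ h) T :=
    isLocLip_field hs (hζ.continuousOn.mono (hI T)) (hc.mono (hI T))
  obtain ⟨η, h0, hη⟩ := exists_global_solution hloc fun T hT ↦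
    exists_isSolOn hs hT (hζ.continuousOn.mono (hI T)) (hc.mono (hI T)) (hk.mono (hI T))
      (fun t _ ↦ forcing_toL2 hs _ _) η₀
  refine ⟨η, (isSolution_iff hs hζ.continuousOn hc (fun _ ↦ rfl) η₀ η).2 ⟨h0, hη⟩,
    fun η' hη' t ht ↦ ?_⟩
  obtain ⟨h0', hd'⟩ := (isSolution_iff hs hζ.continuousOn hc (fun _ ↦ rfl) η₀ η').1 hη'
  exact (isSolOn_of_hasDerivWithinAt h0' hd' t).eqOn (hloc t)
    (isSolOn_of_hasDerivWithinAt h0 hη t) ⟨ht, le_rfl⟩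

end BBM

end

theorem theorem1 (s : ℝ) (hs : 0 ≤ s) (ζ : ℝ → BBM.Hs s) (hζ : ContDiffOn ℝ 2 ζ (Set.Ici 0))
    (hζ' : ∃ ζ' : ℝ → BBM.Hs ((⌊s⌋₊ : ℝ) + 1), ContinuousOn ζ' (Set.Ici 0) ∧
      ∀ t ∈ Set.Ici (0 : ℝ), (ζ' t).toL2 = (ζ t).toL2)
    (η₀ : BBM.Hs s) :
    ∃ η : ℝ → BBM.Hs s, BBM.IsSolution ζ η₀ η ∧
      ∀ η' : ℝ → BBM.Hs s, BBM.IsSolution ζ η₀ η' → Set.EqOn η' η (Set.Ici 0) :=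
  BBM.exists_unique_isSolution hs hζ η₀
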